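/- Let $\rho$ be a probability distribution on $\mathbb{R}$ with finite fourth moment, let $m_1=\int x\,d\rho(x)$ be its mean, which may be arbitrary, and let $\mu_q=\int (x-m_1)^q\,d\rho(x)$, $q=2,3,4$, be its central moments. For each $n\ge 0$ let $X^{(n)}$ be a random real symmetric $n\times n$ matrix whose entries $X_{ij}$, $1\le i\le j\le n$, on and above the diagonal are independent with common distribution $\rho$. Then $f_2(n)=\mathbb{E}[\det(X^{(n)})^2]$ is finite for every $n\ge 0$ (with $f_2(0)=1$), and the exponential generating function $F_2(t)=\sum_{n=0}^{\infty} f_2(n)\frac{t^n}{n!}$ converges for every real $t$ with $|\mu_2 t|<1$ and equals $$F_2(t)=\left(1+2m_1\mu_3t^2+m_1^2\left(\mu_3^2t^4+\frac{t}{1-\mu_2^2t^2}+\frac{2\mu_2t^2}{1-\mu_2t}\right)\right)\frac{\exp\left(\frac{(\mu_4-3\mu_2^2)t^2}{2}-\mu_2t\right)}{(1-\mu_2t)^2\sqrt{1-\mu_2^2t^2}}.$$ -/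

import Mathlib

open MeasureTheory ProbabilityTheory

/-- `X` is a random real symmetric `n × n` matrix, defined on the probability space `(Ω, P)`,
whose entries on and above the diagonal are independent, all with distribution `ρ`. -/
structure IsIIDSymmetric {Ω : Type*} [MeasurableSpace Ω] {n : ℕ} (ρ : Measure ℝ)
    (P : Measure Ω) (X : Ω → Matrix (Fin n) (Fin n) ℝ) : Prop where
  symm : ∀ ω, (X ω).IsSymm
  hasLaw : ∀ i j : Fin n, i ≤ j → HasLaw (fun ω => X ω i j) ρ P
  indep : iIndepFun (fun (p : {p : Fin n × Fin n // p.1 ≤ p.2}) ω => X ω p.1.1 p.1.2) P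

/-- The `k`-th moment `E[det(X)^k]` of the determinant of a random square matrix. -/
noncomputable def detMoment {Ω : Type*} [MeasurableSpace Ω] {n : ℕ} (k : ℕ)
    (P : Measure Ω) (X : Ω → Matrix (Fin n) (Fin n) ℝ) : ℝ :=
  ∫ ω, (X ω).det ^ k ∂P

/-! Write X = Y + m₁J, with Y centred and J the all-ones matrix. Since J has rank one, det X = det Y
+ m₁ Σ adj(Y)ᵢⱼ (`det_add_const`). The second moment of det X therefore reduces to E[det²],
E[det·cof] and E[cof·cof] for centred Y.

An unordered entry occurs at most twice in a Leibniz term, so det² has degree at most 4 in each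
entry and only moments up to the fourth matter. Hence ρ can be replaced by a signed law on five
points with the same moments (`exists_quadrature`, `IsIIDSymmetric.detMoment_two_eq_symE`), and
every expectation becomes a finite sum.

Border Y by an independent corner a and vector v. The determinant becomes a det Y − vᵀ adj(Y) v
(`det_border`), and each cofactor is det Y, linear in v, or a multiple of a minus a quadratic form
in v. Integrating out v and a expresses moments in size n+1 through moments in size n. Centring
kills most index patterns. What survives is a(n) = E[det²] in size n, the moments β(n) = E[cofᵢⱼ²]
and γ(n) = E[cofᵢᵢ cofⱼⱼ] for i ≠ j in size n+2, and multiples of a by μ₃ or μ₃², which come from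
E[det·cofᵢⱼ] and from E[cofᵢⱼ cofₖₗ] with four distinct indices.

For the exponential generating functions A, B, C of a, β, γ the recursions read B = μ₂(A + tB), C =
μ₂²(tA + t²C) and A' = (μ₂ + μ₄t)A + μ₂²t²(C + 2B). Eliminating B and C leaves a linear ODE for A,
solved by an integrating factor (`DetMomentRecursion.tsum_eq`). The answer is A + 2m₁μ₃t²A + m₁²(tA
+ t²C + 2t²B + μ₃²t⁴A). -/

open Finset Matrix

/-! ### Finite signed expectations -/

section WeightedExpectation

variable {K : Type*} [Fintype K] (p z : K → ℝ)

/-- The expectation of `f` over a family of independent coordinates, each taking the value `z k`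
with (signed) weight `p k`. -/
noncomputable def wexp {ι : Type*} [Fintype ι] [DecidableEq ι] (f : (ι → ℝ) → ℝ) : ℝ :=
  ∑ x : ι → K, (∏ i, p (x i)) * f fun i => z (x i)

variable {ι κ : Type*} [Fintype ι] [DecidableEq ι] [Fintype κ] [DecidableEq κ]

theorem wexp_add (f g : (ι → ℝ) → ℝ) :
    wexp p z (fun x => f x + g x) = wexp p z f + wexp p z g := by
  simp only [wexp, mul_add, sum_add_distrib]

theorem wexp_neg (f : (ι → ℝ) → ℝ) :
    wexp p z (fun x => -f x) = -wexp p z f := by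
  simp only [wexp, mul_neg, sum_neg_distrib]

theorem wexp_const_mul (c : ℝ) (f : (ι → ℝ) → ℝ) :
    wexp p z (fun x => c * f x) = c * wexp p z f := by
  simp only [wexp, mul_sum]
  exact sum_congr rfl fun x _ => by ring

theorem wexp_mul_const (c : ℝ) (f : (ι → ℝ) → ℝ) :
    wexp p z (fun x => f x * c) = wexp p z f * c := by
  simp only [mul_comm _ c, wexp_const_mul]

theorem wexp_sum {α : Type*} (s : Finset α) (f : α → (ι → ℝ) → ℝ) :
    wexp p z (fun x => ∑ a ∈ s, f a x) = ∑ a ∈ s, wexp p z (f a) := by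
  simp only [wexp, mul_sum]
  exact sum_comm

theorem wexp_prod (g : ι → ℝ → ℝ) :
    wexp p z (fun x => ∏ i, g i (x i)) = ∏ i, ∑ k, p k * g i (z k) := by
  rw [Fintype.prod_sum]
  exact sum_congr rfl fun x _ => prod_mul_distrib.symm

theorem wexp_equiv (e : ι ≃ κ) (f : (ι → ℝ) → ℝ) :
    wexp p z f = wexp p z fun y : κ → ℝ => f fun i => y (e i) := by
  unfold wexp
  rw [← (e.arrowCongr (Equiv.refl K)).symm.sum_comp]
  refine sum_congr rfl fun x _ => ?_
  congr 1
  rw [← e.prod_comp]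
  rfl

theorem wexp_sumType (f : (ι ⊕ κ → ℝ) → ℝ) :
    wexp p z f = wexp p z fun y : κ → ℝ => wexp p z fun x : ι → ℝ => f (Sum.elim x y) := by
  unfold wexp
  rw [← (Equiv.sumArrowEquivProdArrow ι κ K).symm.sum_comp, Fintype.sum_prod_type_right]
  refine sum_congr rfl fun y _ => ?_
  rw [mul_sum]
  refine sum_congr rfl fun x _ => ?_
  rw [Fintype.prod_sum_type, ← mul_assoc]
  congr 1
  · simp [Equiv.sumArrowEquivProdArrow, mul_comm]
  · congr 1
    ext (i | i) <;> simp [Equiv.sumArrowEquivProdArrow]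

/-- The `k`-th moment of a single coordinate. -/
noncomputable def wmoment (k : ℕ) : ℝ := ∑ i, p i * z i ^ k

theorem wexp_monomial (k : ι → ℕ) :
    wexp p z (fun x => ∏ i, x i ^ k i) = ∏ i, wmoment p z (k i) :=
  wexp_prod p z fun i t => t ^ k i

/-- The signed law is normalised and centred, with central moments `μ₂`, `μ₃`, `μ₄`. -/
structure IsCentred (μ₂ μ₃ μ₄ : ℝ) : Prop where
  zero : wmoment p z 0 = 1
  one : wmoment p z 1 = 0
  two : wmoment p z 2 = μ₂
  three : wmoment p z 3 = μ₃
  four : wmoment p z 4 = μ₄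

variable {p z} {μ₂ μ₃ μ₄ : ℝ}

theorem IsCentred.wexp_const (h : IsCentred p z μ₂ μ₃ μ₄) (c : ℝ) :
    wexp p z (fun _ : ι → ℝ => c) = c := by
  have := wexp_monomial p z (fun _ : ι => 0)
  simp only [pow_zero, prod_const_one, h.zero] at this
  simpa [this] using wexp_const_mul p z c (fun _ : ι → ℝ => (1 : ℝ))

theorem prod_pow_ite {i : ι} (x : ι → ℝ) : x i = ∏ l, x l ^ (if l = i then 1 else 0) := by
  simp [pow_ite]

theorem IsCentred.wexp_coord (h : IsCentred p z μ₂ μ₃ μ₄) (i : ι) :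
    wexp p z (fun x : ι → ℝ => x i) = 0 := by
  simp_rw [prod_pow_ite (i := i), wexp_monomial]
  exact prod_eq_zero (mem_univ i) (by simp [h.one])

theorem IsCentred.wexp_coord₂ (h : IsCentred p z μ₂ μ₃ μ₄) (i j : ι) :
    wexp p z (fun x : ι → ℝ => x i * x j) = if i = j then μ₂ else 0 := by
  simp_rw [prod_pow_ite (i := i), prod_pow_ite (i := j), ← prod_mul_distrib, ← pow_add,
    wexp_monomial]
  split_ifs with hij
  · subst hij
    rw [prod_eq_single i (fun l _ hl => by simp [hl, h.zero]) (by simp)]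
    simp [h.two]
  · exact prod_eq_zero (mem_univ i) (by simp [hij, h.one])

theorem IsCentred.wexp_coord₃ (h : IsCentred p z μ₂ μ₃ μ₄) (i j k : ι) :
    wexp p z (fun x : ι → ℝ => x i * x j * x k) = if i = j then if j = k then μ₃ else 0 else 0 := by
  simp_rw [prod_pow_ite (i := i), prod_pow_ite (i := j), prod_pow_ite (i := k),
    ← prod_mul_distrib, ← pow_add, wexp_monomial]
  split_ifs with hij hjk
  · subst hij hjk
    rw [prod_eq_single i (fun l _ hl => by simp [hl, h.zero]) (by simp)]
    simp [h.three]
  · subst hij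
    exact prod_eq_zero (mem_univ k) (by simp [Ne.symm hjk, h.one])
  · by_cases hik : i = k
    · subst hik
      exact prod_eq_zero (mem_univ j) (by simp [Ne.symm hij, h.one])
    · exact prod_eq_zero (mem_univ i) (by simp [hij, hik, h.one])

/-- Wick's formula with its correction: the three pairings, plus the fourth cumulant on the full
diagonal, where all three pairings are counted at once. -/
theorem IsCentred.wexp_coord₄ (h : IsCentred p z μ₂ μ₃ μ₄) (i j k l : ι) :
    wexp p z (fun x : ι → ℝ => x i * x j * (x k * x l)) =
      (if i = j then if k = l then μ₂ ^ 2 else 0 else 0)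
      + (if i = k then if j = l then μ₂ ^ 2 else 0 else 0)
      + (if i = l then if j = k then μ₂ ^ 2 else 0 else 0)
      + (if i = j then if j = k then if k = l then μ₄ - 3 * μ₂ ^ 2 else 0 else 0 else 0) := by
  simp_rw [prod_pow_ite (i := i), prod_pow_ite (i := j), prod_pow_ite (i := k),
    prod_pow_ite (i := l), ← prod_mul_distrib, ← pow_add, wexp_monomial]
  have pair : ∀ a b : ι, a ≠ b → ∀ g : ι → ℕ, g a = 2 → g b = 2 →
      (∀ c, c ≠ a → c ≠ b → g c = 0) → ∏ c, wmoment p z (g c) = μ₂ ^ 2 := by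
    intro a b hab g ha hb hg
    rw [prod_eq_mul a b hab (fun c _ hc => by rw [hg c hc.1 hc.2, h.zero]) (by simp) (by simp),
      ha, hb, h.two, sq]
  have single : ∀ a : ι, ∀ g : ι → ℕ, g a = 1 → ∏ c, wmoment p z (g c) = 0 :=
    fun a g ha => prod_eq_zero (mem_univ a) (by rw [ha, h.one])
  by_cases hij : i = j
  · subst hij
    by_cases hkl : k = l
    · subst hkl
      by_cases hik : i = k
      · subst hik
        rw [prod_eq_single i (fun l _ hl => by simp [hl, h.zero]) (by simp)]
        simp [h.four]
        ring
      · rw [pair i k hik _ (by simp [hik]) (by simp [Ne.symm hik])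
          (fun c h1 h2 => by simp [h1, h2])]
        simp [hik]
    · by_cases hik : i = k
      · subst hik
        rw [single l _ (by simp [Ne.symm hkl])]
        simp [hkl]
      · rw [single k _ (by simp [Ne.symm hik, hkl])]
        simp [hkl, hik]
  · by_cases hik : i = k
    · subst hik
      by_cases hjl : j = l
      · subst hjl
        rw [pair i j hij _ (by simp [hij]) (by simp [Ne.symm hij])
          (fun c h1 h2 => by simp [h1, h2])]
        simp [hij]
      · rw [single j _ (by simp [Ne.symm hij, hjl])]
        simp [hij, hjl, Ne.symm hij]
    · by_cases hil : i = l
      · subst hil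
        by_cases hjk : j = k
        · subst hjk
          rw [pair i j hij _ (by simp [hij]) (by simp [Ne.symm hij])
            (fun c h1 h2 => by simp [h1, h2])]
          simp [hij]
        · rw [single j _ (by simp [Ne.symm hij, hjk])]
          simp [hij, hik, hjk]
      · rw [single i _ (by simp [hij, hik, hil])]
        simp [hij, hik, hil]

theorem IsCentred.wexp_lin (h : IsCentred p z μ₂ μ₃ μ₄) (c : ι → ℝ) :
    wexp p z (fun x : ι → ℝ => ∑ j, x j * c j) = 0 := by
  simp [wexp_sum, wexp_mul_const, h.wexp_coord]

theorem IsCentred.wexp_lin_mul_lin (h : IsCentred p z μ₂ μ₃ μ₄) (c d : ι → ℝ) :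
    wexp p z (fun x : ι → ℝ => (∑ j, x j * c j) * ∑ j, x j * d j) = μ₂ * ∑ j, c j * d j := by
  have : ∀ (x : ι → ℝ) (i j : ι), x i * c i * (x j * d j) = x i * x j * (c i * d j) :=
    fun x i j => by ring
  simp_rw [sum_mul_sum, this, wexp_sum, wexp_mul_const, h.wexp_coord₂]
  simp [mul_sum]

theorem IsCentred.wexp_quad (h : IsCentred p z μ₂ μ₃ μ₄) (N : Matrix ι ι ℝ) :
    wexp p z (fun x : ι → ℝ => ∑ i, ∑ j, x i * x j * N i j) = μ₂ * ∑ i, N i i := by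
  simp_rw [wexp_sum, wexp_mul_const, h.wexp_coord₂]
  simp [mul_sum]

theorem IsCentred.wexp_lin_mul_quad (h : IsCentred p z μ₂ μ₃ μ₄) (c : ι → ℝ) (N : Matrix ι ι ℝ) :
    wexp p z (fun x : ι → ℝ => (∑ j, x j * c j) * ∑ i, ∑ j, x i * x j * N i j) =
      μ₃ * ∑ i, c i * N i i := by
  have : ∀ (x : ι → ℝ) (l i j : ι), x l * c l * (x i * x j * N i j) =
      x l * x i * x j * (c l * N i j) := fun x l i j => by ring
  simp_rw [sum_mul_sum, mul_sum, this, wexp_sum, wexp_mul_const, h.wexp_coord₃]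
  simp

theorem IsCentred.wexp_quad_mul_quad (h : IsCentred p z μ₂ μ₃ μ₄) (M N : Matrix ι ι ℝ) :
    wexp p z (fun x : ι → ℝ =>
        (∑ i, ∑ j, x i * x j * M i j) * ∑ i, ∑ j, x i * x j * N i j) =
      μ₂ ^ 2 * ((∑ i, ∑ k, M i i * N k k) + ∑ i, ∑ j, M i j * N i j + ∑ i, ∑ j, M i j * N j i)
        + (μ₄ - 3 * μ₂ ^ 2) * ∑ i, M i i * N i i := by
  have : ∀ (x : ι → ℝ) (i j k l : ι), x i * x j * M i j * (x k * x l * N k l) =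
      x i * x j * (x k * x l) * (M i j * N k l) := fun x i j k l => by ring
  simp_rw [sum_mul, mul_sum, this, wexp_sum, wexp_mul_const, h.wexp_coord₄, add_mul,
    sum_add_distrib, ite_mul, zero_mul]
  simp [mul_sum, mul_add]

end WeightedExpectation

/-! ### Bordered matrices -/

section Border

variable {R : Type*} [CommRing R] {V : Type*} [Fintype V] [DecidableEq V]

/-- The matrix `Y` bordered by a corner entry `a`, a first column `u` and a first row `w`. -/
def border (a : R) (u w : V → R) (Y : Matrix V V R) : Matrix (Option V) (Option V) R
  | none, none => a
  | none, some j => w j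
  | some i, none => u i
  | some i, some j => Y i j

theorem det_border_zero_row (a : R) (u : V → R) (Y : Matrix V V R) :
    (border a u 0 Y).det = a * Y.det := by
  rw [← det_reindex_self (Equiv.optionEquivSumPUnit.{0} V)]
  have : reindex (Equiv.optionEquivSumPUnit.{0} V) (Equiv.optionEquivSumPUnit.{0} V) (border a u 0 Y) =
      fromBlocks Y (of fun i _ => u i) 0 (of fun _ _ => a) := by
    ext (i | i) (j | j) <;> rfl
  rw [this, det_fromBlocks_zero₂₁, mul_comm]
  simp

theorem adjugate_border_none_none (a : R) (u w : V → R) (Y : Matrix V V R) :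
    (border a u w Y).adjugate none none = Y.det := by
  rw [adjugate_apply]
  have : (border a u w Y).updateRow none (Pi.single none 1) = border 1 u 0 Y := by
    ext (_ | i) (_ | j) <;> simp [updateRow_apply, border]
  rw [this, det_border_zero_row, one_mul]

theorem det_updateRow_eq_sum (Y : Matrix V V R) (j : V) (w : V → R) :
    (Y.updateRow j w).det = ∑ i, w i * Y.adjugate i j := by
  rw [← cramer_transpose_apply, cramer_eq_adjugate_mulVec, ← adjugate_transpose]
  simp [mulVec, dotProduct, mul_comm]

theorem adjugate_border_none_some (a : R) (u w : V → R) (Y : Matrix V V R) (k : V) :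
    (border a u w Y).adjugate none (some k) = -∑ i, w i * Y.adjugate i k := by
  rw [adjugate_apply, ← det_updateRow_eq_sum]
  set B := (border a u w Y).updateRow (some k) (Pi.single none 1)
  -- Row `some k` of `B` is the unit vector at `none`. Swapping it to the top gives a border with
  -- zero first row, and the transposition accounts for the sign.
  have h : B.submatrix (Equiv.swap none (some k)) id =
      border 1 (Function.update u k a) 0 (Y.updateRow k w) := by
    ext (_ | i) (_ | j)
    · simp [B, border]
    · simp [B, border]
    · by_cases hi : i = k
      · subst hi; simp [B, border]
      · have : Equiv.swap none (some k) (some i) = some i :=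
          Equiv.swap_apply_of_ne_of_ne (by simp) (by simpa using hi)
        simp [B, border, this, updateRow_apply, hi]
    · by_cases hi : i = k
      · subst hi; simp [B, border]
      · have : Equiv.swap none (some k) (some i) = some i :=
          Equiv.swap_apply_of_ne_of_ne (by simp) (by simpa using hi)
        simp [B, border, this, updateRow_apply, hi]
  have h2 := det_permute (Equiv.swap none (some k)) B
  rw [h, det_border_zero_row, Equiv.Perm.sign_swap (by simp)] at h2
  simp only [one_mul, Units.val_neg, Units.val_one, Int.cast_neg, Int.cast_one, neg_mul] at h2
  rw [h2, neg_neg]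

theorem det_border (a : R) (u w : V → R) (Y : Matrix V V R) :
    (border a u w Y).det = a * Y.det - ∑ i, ∑ j, w i * u j * Y.adjugate i j := by
  rw [det_eq_sum_mul_adjugate_col _ none, Fintype.sum_option, adjugate_border_none_none]
  simp_rw [adjugate_border_none_some]
  rw [sum_comm]
  simp only [border, mul_neg, sum_neg_distrib, mul_sum, sub_eq_add_neg]
  congr 2
  exact sum_congr rfl fun i _ => sum_congr rfl fun j _ => by ring

omit [Fintype V] in
theorem border_updateRow_some (a : R) (u w : V → R) (Y : Matrix V V R) (k l : V) :
    (border a u w Y).updateRow (some l) (Pi.single (some k) 1) =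
      border a (Function.update u l 0) w (Y.updateRow l (Pi.single k 1)) := by
  ext (_ | i) (_ | j)
  · simp [border]
  · simp [border]
  · by_cases hi : i = l
    · subst hi; simp [border]
    · simp [border, hi, updateRow_apply]
  · by_cases hi : i = l
    · subst hi; simp [border, Pi.single_apply]
    · simp [border, hi, updateRow_apply]

/-- The quadratic form by which the `(k, l)` cofactor depends on a symmetric border. -/
def borderForm (Y : Matrix V V R) (k l : V) : Matrix V V R :=
  of fun i j => if j = l then 0 else (Y.updateRow l (Pi.single k 1)).adjugate i j

/-- The cofactor is the determinant after row `some l` is replaced by a unit vector. This is again a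
bordered matrix, whose first column vanishes at `l`; that is why column `l` of `borderForm` is zero.
-/
theorem adjugate_border_some_some (a : R) (v : V → R) (Y : Matrix V V R) (k l : V) :
    (border a v v Y).adjugate (some k) (some l) =
      a * Y.adjugate k l - ∑ i, ∑ j, v i * v j * borderForm Y k l i j := by
  rw [adjugate_apply, border_updateRow_some, det_border, adjugate_apply]
  congr 1
  refine sum_congr rfl fun i _ => sum_congr rfl fun j _ => ?_
  by_cases hj : j = l <;> simp [borderForm, hj]

theorem borderForm_self (Y : Matrix V V R) {k l : V} (h : k ≠ l) : borderForm Y k l k k = 0 := by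
  simp only [borderForm, of_apply, h, if_false, adjugate_apply]
  exact det_zero_of_row_eq h (by simp [updateRow_ne h.symm])

theorem borderForm_self' (Y : Matrix V V R) (k l i : V) : borderForm Y k l i l = 0 := by
  simp [borderForm]

theorem borderForm_border_none (a : R) (u w : V → R) (Y : Matrix V V R) (k l : V) :
    borderForm (border a u w Y) (some k) (some l) none none = Y.adjugate k l := by
  rw [borderForm, of_apply, if_neg (by simp), border_updateRow_some, adjugate_border_none_none,
    adjugate_apply]

theorem borderForm_border_some (a : R) (u w : V → R) (Y : Matrix V V R) (j : V) :
    borderForm (border a u w Y) none none (some j) (some j) = Y.adjugate j j := by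
  have : (border a u w Y).updateRow none (Pi.single none 1) = border 1 u 0 Y := by
    ext (_ | i) (_ | j) <;> simp [updateRow_apply, border]
  rw [borderForm, of_apply, if_neg (by simp), this, adjugate_apply, border_updateRow_some,
    det_border_zero_row, one_mul, adjugate_apply]

/-- A unipotent column operation turns the border of `Y + m` by column −m and zero row into the
border of `Y` by column −m and row 1, so the two determinants agree. -/
theorem det_add_const (Y : Matrix V V R) (m : R) :
    (Y + of fun _ _ => m).det = Y.det + m * ∑ i, ∑ j, Y.adjugate i j := by
  have h := det_border (1 : R) (fun _ => -m) (fun _ => 1) Y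
  have h2 := det_border_zero_row (1 : R) (fun _ => -m) (Y + of fun _ _ => m)
  have h3 : border (1 : R) (fun _ => -m) (fun _ => 1) Y =
      border (1 : R) (fun _ => -m) 0 (Y + of fun _ _ => m) * border 1 0 (fun _ => 1) 1 := by
    ext (_ | i) (_ | j) <;> simp [border, mul_apply, Fintype.sum_option, one_apply]
  have h4 : (border (1 : R) 0 (fun _ : V => 1) 1).det = 1 := by
    rw [det_border]; simp
  rw [h3, det_mul, h4, mul_one, h2] at h
  simpa [mul_sum, sub_eq_add_neg] using h

end Border

/-! ### Expectations over symmetric matrices -/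

section SymmetricExpectation

variable {K : Type*} [Fintype K] (p z : K → ℝ)

/-- The expectation of a function of a symmetric matrix with independent entries on and above
the diagonal. -/
noncomputable def symE (V : Type*) [Fintype V] [DecidableEq V] (f : Matrix V V ℝ → ℝ) : ℝ :=
  wexp p z fun y : Sym2 V → ℝ => f (of fun i j => y s(i, j))

variable {V W : Type*} [Fintype V] [DecidableEq V] [Fintype W] [DecidableEq W]

/-- The equivalence of unordered pairs induced by an equivalence. -/
def sym2CongrEquiv {V W : Type*} (e : V ≃ W) : Sym2 V ≃ Sym2 W where
  toFun := Sym2.map e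
  invFun := Sym2.map e.symm
  left_inv y := by simp [Sym2.map_map]
  right_inv y := by simp [Sym2.map_map]

theorem symE_equiv (e : V ≃ W) (f : Matrix V V ℝ → ℝ) :
    symE p z V f = symE p z W fun Y => f (Y.submatrix e e) :=
  wexp_equiv p z (sym2CongrEquiv e) _

/-- The unordered pairs in `Option V` are the pairs containing `none` and those in `V`. -/
noncomputable def sym2OptionEquiv (V : Type*) : V ⊕ Unit ⊕ Sym2 V ≃ Sym2 (Option V) :=
  Equiv.ofBijective
    (Sum.elim (fun v => s(none, some v)) (Sum.elim (fun _ => s(none, none)) (Sym2.map some))) <| by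
    constructor
    · rintro (v | _ | y) (v' | _ | y') h
      · simpa using h
      · simp at h
      · induction y' with | _ i j => simp at h
      · simp at h
      · rfl
      · induction y' with | _ i j => simp at h
      · induction y with | _ i j => simp at h
      · induction y with | _ i j => simp at h
      · have := Sym2.map.injective (Option.some_injective V) h
        rw [this]
    · intro y
      induction y with
      | _ i j =>
        rcases i with _ | i <;> rcases j with _ | j
        · exact ⟨.inr (.inl ()), rfl⟩
        · exact ⟨.inl j, rfl⟩
        · exact ⟨.inl i, Sym2.eq_swap⟩
        · exact ⟨.inr (.inr s(i, j)), rfl⟩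

/-- The basis of every recursion: the first row and the corner are independent of the remaining
matrix and can be integrated out first. -/
theorem symE_option (f : Matrix (Option V) (Option V) ℝ → ℝ) :
    symE p z (Option V) f = symE p z V fun Y => wexp p z fun a : Unit → ℝ =>
      wexp p z fun v : V → ℝ => f (border (a ()) v v Y) := by
  have h1 : ∀ j : V, (sym2OptionEquiv V).symm s(none, some j) = .inl j := fun j => by
    rw [Equiv.symm_apply_eq]; rfl
  have h2 : ∀ j : V, (sym2OptionEquiv V).symm s(some j, none) = .inl j := fun j => by
    rw [Sym2.eq_swap, h1]
  have h3 : (sym2OptionEquiv V).symm s(none, none) = .inr (.inl ()) := by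
    rw [Equiv.symm_apply_eq]; rfl
  have h4 : ∀ i j : V, (sym2OptionEquiv V).symm s(some i, some j) = .inr (.inr s(i, j)) :=
    fun i j => by rw [Equiv.symm_apply_eq]; rfl
  unfold symE
  rw [wexp_equiv p z (sym2OptionEquiv V).symm, wexp_sumType, wexp_sumType]
  congr! 2 with y
  congr! 2 with a
  congr! 2 with v
  congr 1
  ext (_ | i) (_ | j) <;> simp [border, h1, h2, h3, h4]

theorem symE_congr {f g : Matrix V V ℝ → ℝ} (h : ∀ Y, Y.IsSymm → f Y = g Y) :
    symE p z V f = symE p z V g := by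
  unfold symE
  congr! 2 with y
  exact h _ (by ext i j; simp [Sym2.eq_swap])

theorem symE_add (f g : Matrix V V ℝ → ℝ) :
    symE p z V (fun Y => f Y + g Y) = symE p z V f + symE p z V g := wexp_add p z _ _

theorem symE_const_mul (c : ℝ) (f : Matrix V V ℝ → ℝ) :
    symE p z V (fun Y => c * f Y) = c * symE p z V f := wexp_const_mul p z _ _

theorem symE_sum {α : Type*} (s : Finset α) (f : α → Matrix V V ℝ → ℝ) :
    symE p z V (fun Y => ∑ a ∈ s, f a Y) = ∑ a ∈ s, symE p z V (f a) := wexp_sum p z _ _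

end SymmetricExpectation

/-! ### Second moments of cofactors -/

section CofactorMoments

variable {K : Type*} [Fintype K] (p z : K → ℝ)
variable (V : Type*) [Fintype V] [DecidableEq V]
variable {W : Type*} [Fintype W] [DecidableEq W]

/-- The second moment of the determinant. -/
noncomputable def detSq : ℝ := symE p z V fun Y => Y.det * Y.det

/-- The mixed moment of the determinant and a cofactor. -/
noncomputable def detCof (i j : V) : ℝ := symE p z V fun Y => Y.det * Y.adjugate i j

/-- The mixed moment of two cofactors. -/
noncomputable def cofCof (i j k l : V) : ℝ :=
  symE p z V fun Y => Y.adjugate i j * Y.adjugate k l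

variable {V}

theorem detSq_equiv (e : V ≃ W) : detSq p z V = detSq p z W := by
  unfold detSq
  rw [symE_equiv p z e]
  simp

theorem detCof_equiv (e : V ≃ W) (i j : V) : detCof p z V i j = detCof p z W (e i) (e j) := by
  unfold detCof
  rw [symE_equiv p z e]
  simp [adjugate_submatrix_equiv_self]

theorem cofCof_equiv (e : V ≃ W) (i j k l : V) :
    cofCof p z V i j k l = cofCof p z W (e i) (e j) (e k) (e l) := by
  unfold cofCof
  rw [symE_equiv p z e]
  simp [adjugate_submatrix_equiv_self]

theorem cofCof_swap (i j k l : V) : cofCof p z V i j k l = cofCof p z V k l i j := by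
  simp only [cofCof, mul_comm]

theorem cofCof_symm_left (i j k l : V) : cofCof p z V i j k l = cofCof p z V j i k l :=
  symE_congr p z fun Y hY => by rw [hY.adjugate.apply]

theorem cofCof_symm_right (i j k l : V) : cofCof p z V i j k l = cofCof p z V i j l k :=
  symE_congr p z fun Y hY => by rw [hY.adjugate.apply l k]

variable {p z} {μ₂ μ₃ μ₄ : ℝ}

theorem IsCentred.wexp_unit (h : IsCentred p z μ₂ μ₃ μ₄) (c d e : ℝ) :
    wexp p z (fun a : Unit → ℝ => c + a () * d + a () * a () * e) = c + μ₂ * e := by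
  rw [wexp_add, wexp_add, wexp_mul_const, wexp_mul_const, h.wexp_const, h.wexp_coord,
    h.wexp_coord₂]
  simp

/-- Template for the moment computations: integrating `v` leaves a quadratic polynomial in the
corner `a`, and integrating the centred `a` sends `a` to 0 and `a * a` to `μ₂`. -/
theorem IsCentred.symE_option_eq (h : IsCentred p z μ₂ μ₃ μ₄)
    {f : Matrix (Option V) (Option V) ℝ → ℝ} {g c d e : Matrix V V ℝ → ℝ}
    (hf : ∀ Y, Y.IsSymm → ∀ a : ℝ, wexp p z (fun v : V → ℝ => f (border a v v Y)) =
      c Y + a * d Y + a * a * e Y) (hg : ∀ Y, Y.IsSymm → c Y + μ₂ * e Y = g Y) :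
    symE p z (Option V) f = symE p z V g := by
  rw [symE_option]
  refine symE_congr p z fun Y hY => ?_
  simp_rw [hf Y hY]
  rw [h.wexp_unit, hg Y hY]

theorem IsCentred.detSq_option (h : IsCentred p z μ₂ μ₃ μ₄) :
    detSq p z (Option V) = μ₂ * detSq p z V
      + μ₂ ^ 2 * ((∑ i, ∑ k, cofCof p z V i i k k) + 2 * ∑ i, ∑ j, cofCof p z V i j i j)
      + (μ₄ - 3 * μ₂ ^ 2) * ∑ i, cofCof p z V i i i i := by
  have key : detSq p z (Option V) = symE p z V fun Y => μ₂ * (Y.det * Y.det)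
      + μ₂ ^ 2 * ((∑ i, ∑ k, Y.adjugate i i * Y.adjugate k k)
        + 2 * ∑ i, ∑ j, Y.adjugate i j * Y.adjugate i j)
      + (μ₄ - 3 * μ₂ ^ 2) * ∑ i, Y.adjugate i i * Y.adjugate i i := by
    refine h.symE_option_eq (c := fun Y => μ₂ ^ 2 * ((∑ i, ∑ k, Y.adjugate i i * Y.adjugate k k)
        + (∑ i, ∑ j, Y.adjugate i j * Y.adjugate i j)
        + ∑ i, ∑ j, Y.adjugate i j * Y.adjugate j i)
        + (μ₄ - 3 * μ₂ ^ 2) * ∑ i, Y.adjugate i i * Y.adjugate i i)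
      (d := fun Y => -2 * Y.det * (μ₂ * ∑ i, Y.adjugate i i))
      (e := fun Y => Y.det * Y.det) (fun Y hY a => ?_) fun Y hY => ?_
    -- The moment formulas are read backwards to gather the right-hand side into a single
    -- expectation over `v`; only a pointwise identity then remains.
    · rw [← h.wexp_quad_mul_quad, ← h.wexp_quad, ← mul_assoc a, ← wexp_const_mul,
        ← wexp_add, ← h.wexp_const (ι := V) (a * a * _), ← wexp_add]
      congr! 2 with v
      rw [det_border]
      ring
    · simp_rw [hY.adjugate.apply]
      ring
  rw [key]
  simp only [symE_add, symE_const_mul, symE_sum]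
  rfl

theorem IsCentred.detCof_none_none (h : IsCentred p z μ₂ μ₃ μ₄) :
    detCof p z (Option V) none none = -μ₂ * ∑ i, detCof p z V i i := by
  have key : detCof p z (Option V) none none = symE p z V fun Y =>
      -μ₂ * ∑ i, Y.det * Y.adjugate i i := by
    refine h.symE_option_eq (c := fun Y => -Y.det * (μ₂ * ∑ i, Y.adjugate i i))
      (d := fun Y => Y.det * Y.det) (e := 0) (fun Y hY a => ?_) fun Y hY => ?_
    · rw [← h.wexp_quad, ← wexp_const_mul, ← h.wexp_const (ι := V) (a * (_ * _)), ← wexp_add,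
        ← h.wexp_const (ι := V) (a * a * _), ← wexp_add]
      congr! 2 with v
      rw [det_border, adjugate_border_none_none]
      simp
      ring
    · simp [← mul_sum]
      ring
  rw [key]
  simp only [symE_const_mul, symE_sum]
  rfl

theorem IsCentred.detCof_none_some (h : IsCentred p z μ₂ μ₃ μ₄) (k : V) :
    detCof p z (Option V) none (some k) = μ₃ * ∑ i, cofCof p z V i i i k := by
  have key : detCof p z (Option V) none (some k) = symE p z V fun Y =>
      μ₃ * ∑ i, Y.adjugate i i * Y.adjugate i k := by
    refine h.symE_option_eq (c := fun Y => μ₃ * ∑ i, Y.adjugate i k * Y.adjugate i i)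
      (d := fun Y => -Y.det * 0) (e := 0) (fun Y hY a => ?_) fun Y hY => ?_
    · rw [← h.wexp_lin_mul_quad, ← h.wexp_lin (Y.adjugate · k), ← mul_assoc a, ← wexp_const_mul,
        ← wexp_add]
      simp only [Pi.zero_apply, mul_zero, add_zero]
      congr! 2 with v
      rw [det_border, adjugate_border_none_some]
      ring
    · simp [mul_comm]
  rw [key]
  simp only [symE_const_mul, symE_sum]
  rfl

theorem IsCentred.cofCof_none_none_none_none (h : IsCentred p z μ₂ μ₃ μ₄) :
    cofCof p z (Option V) none none none none = detSq p z V := by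
  refine h.symE_option_eq (c := fun Y => Y.det * Y.det) (d := 0) (e := 0)
    (fun Y hY a => ?_) fun Y hY => by simp
  simp [adjugate_border_none_none, h.wexp_const]

theorem IsCentred.cofCof_none_none_none_some (h : IsCentred p z μ₂ μ₃ μ₄) (k : V) :
    cofCof p z (Option V) none none none (some k) = 0 := by
  have key : cofCof p z (Option V) none none none (some k) = symE p z V fun Y => 0 * 0 := by
    refine h.symE_option_eq (c := 0) (d := 0) (e := 0) (fun Y hY a => ?_) fun Y hY => by simp
    simp only [adjugate_border_none_none, adjugate_border_none_some, wexp_const_mul, wexp_neg]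
    simp [h.wexp_lin]
  rw [key, symE_const_mul, zero_mul]

theorem IsCentred.cofCof_none_some_none_some (h : IsCentred p z μ₂ μ₃ μ₄) (j k : V) :
    cofCof p z (Option V) none (some j) none (some k) = μ₂ * ∑ i, cofCof p z V i j i k := by
  have key : cofCof p z (Option V) none (some j) none (some k) = symE p z V fun Y =>
      μ₂ * ∑ i, Y.adjugate i j * Y.adjugate i k := by
    refine h.symE_option_eq (c := fun Y => μ₂ * ∑ i, Y.adjugate i j * Y.adjugate i k)
      (d := 0) (e := 0) (fun Y hY a => ?_) fun Y hY => by simp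
    simp only [adjugate_border_none_some, neg_mul_neg, h.wexp_lin_mul_lin]
    simp
  rw [key]
  simp only [symE_const_mul, symE_sum]
  rfl

theorem IsCentred.cofCof_none_some_some_some (h : IsCentred p z μ₂ μ₃ μ₄) (j k l : V) :
    cofCof p z (Option V) none (some j) (some k) (some l) =
      μ₃ * ∑ i, symE p z V fun Y => Y.adjugate i j * borderForm Y k l i i := by
  have key : cofCof p z (Option V) none (some j) (some k) (some l) = symE p z V fun Y =>
      μ₃ * ∑ i, Y.adjugate i j * borderForm Y k l i i := by
    refine h.symE_option_eq (c := fun Y => μ₃ * ∑ i, Y.adjugate i j * borderForm Y k l i i)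
      (d := fun Y => -Y.adjugate k l * 0) (e := 0) (fun Y hY a => ?_) fun Y hY => by simp
    rw [← h.wexp_lin_mul_quad, ← h.wexp_lin (Y.adjugate · j), ← mul_assoc a, ← wexp_const_mul,
      ← wexp_add]
    simp only [Pi.zero_apply, mul_zero, add_zero]
    congr! 2 with v
    rw [adjugate_border_some_some, adjugate_border_none_some]
    ring
  rw [key]
  simp only [symE_const_mul, symE_sum]

theorem IsCentred.cofCof_none_none_some_some (h : IsCentred p z μ₂ μ₃ μ₄) (k l : V) :
    cofCof p z (Option V) none none (some k) (some l) =
      -μ₂ * ∑ i, symE p z V fun Y => Y.det * borderForm Y k l i i := by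
  have key : cofCof p z (Option V) none none (some k) (some l) = symE p z V fun Y =>
      -μ₂ * ∑ i, Y.det * borderForm Y k l i i := by
    refine h.symE_option_eq (c := fun Y => -Y.det * (μ₂ * ∑ i, borderForm Y k l i i))
      (d := fun Y => Y.det * Y.adjugate k l) (e := 0) (fun Y hY a => ?_) fun Y hY => ?_
    · rw [← h.wexp_quad, ← wexp_const_mul, ← h.wexp_const (ι := V) (a * (_ * _)), ← wexp_add,
        ← h.wexp_const (ι := V) (a * a * _), ← wexp_add]
      congr! 2 with v
      rw [adjugate_border_some_some, adjugate_border_none_none]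
      simp
      ring
    · simp [← mul_sum]
      ring
  rw [key]
  simp only [symE_const_mul, symE_sum]

end CofactorMoments

theorem exists_equiv_option_fin {W : Type*} [Fintype W] [DecidableEq W] {n : ℕ}
    (hW : Fintype.card W = n + 1) (i : W) : ∃ e : W ≃ Option (Fin n), e i = none := by
  have hc : Fintype.card {b // b ≠ i} = n := by
    rw [Fintype.card_subtype_compl, hW]; simp
  exact ⟨(Equiv.optionSubtypeNe i).symm.trans (Fintype.equivFinOfCardEq hc).optionCongr, by simp⟩

theorem exists_equiv_option_fin₂ {W : Type*} [Fintype W] [DecidableEq W] {n : ℕ}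
    (hW : Fintype.card W = n + 2) {i j : W} (hij : i ≠ j) :
    ∃ e : W ≃ Option (Option (Fin n)), e i = none ∧ e j = some none := by
  obtain ⟨e, he⟩ := exists_equiv_option_fin hW i
  obtain ⟨j', hj'⟩ : ∃ j', e j = some j' := by
    rw [← Option.ne_none_iff_exists', ← he]
    exact e.injective.ne hij.symm
  obtain ⟨e', he'⟩ := exists_equiv_option_fin (Fintype.card_fin (n + 1)) j'
  exact ⟨e.trans e'.optionCongr, by simp [he], by simp [hj', he']⟩

/-! ### Moments by index pattern, and the recursions between them. -/

section Recursion

variable {K : Type*} [Fintype K] {p z : K → ℝ} {μ₂ μ₃ μ₄ : ℝ}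
variable {W : Type} [Fintype W] [DecidableEq W]

variable (p z) in
/-- The second moment of the determinant of a centred symmetric matrix of size `n`. -/
noncomputable def detSqFin (n : ℕ) : ℝ := detSq p z (Fin n)

theorem detSq_of_card {n : ℕ} (hW : Fintype.card W = n) : detSq p z W = detSqFin p z n :=
  detSq_equiv p z (Fintype.equivFinOfCardEq hW)

omit [Fintype W] [DecidableEq W] in
theorem exists_eq_some_of_ne {V : Type*} (e : W ≃ Option V) {i j : W} (hij : i ≠ j)
    (hi : e i = none) : ∃ j', e j = some j' := by
  rw [← Option.ne_none_iff_exists', ← hi]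
  exact e.injective.ne hij.symm

omit [DecidableEq W] in
theorem exists_card_eq_succ (i : W) : ∃ n, Fintype.card W = n + 1 :=
  Nat.exists_eq_succ_of_ne_zero (Fintype.card_pos_iff.2 ⟨i⟩).ne'

theorem IsCentred.cofCof_self_self (h : IsCentred p z μ₂ μ₃ μ₄) {n : ℕ}
    (hW : Fintype.card W = n + 1) (i : W) : cofCof p z W i i i i = detSqFin p z n := by
  obtain ⟨e, he⟩ := exists_equiv_option_fin hW i
  rw [cofCof_equiv p z e, he, h.cofCof_none_none_none_none, detSqFin]

theorem IsCentred.cofCof_self_left (h : IsCentred p z μ₂ μ₃ μ₄) {i j : W} (hij : i ≠ j) :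
    cofCof p z W i i i j = 0 := by
  obtain ⟨n, hn⟩ := exists_card_eq_succ i
  obtain ⟨e, he⟩ := exists_equiv_option_fin hn i
  obtain ⟨j', hj'⟩ := exists_eq_some_of_ne e hij he
  rw [cofCof_equiv p z e, he, hj', h.cofCof_none_none_none_some]

/-- Removing the index `i` gives −μ₂ times a sum of the same kind of moment in one size less, so the
claim descends to an empty sum. -/
theorem IsCentred.detCof_self (h : IsCentred p z μ₂ μ₃ μ₄) (i : W) : detCof p z W i i = 0 := by
  obtain ⟨n, hn⟩ := exists_card_eq_succ i
  induction n generalizing W with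
  | zero =>
    obtain ⟨e, he⟩ := exists_equiv_option_fin hn i
    rw [detCof_equiv p z e, he, h.detCof_none_none]
    simp
  | succ n ih =>
    obtain ⟨e, he⟩ := exists_equiv_option_fin hn i
    rw [detCof_equiv p z e, he, h.detCof_none_none, sum_eq_zero, mul_zero]
    exact fun j _ => ih j (Fintype.card_fin _)

/-- In the border at `i` the determinant is quadratic and the cofactor linear, whence `μ₃`. In the
resulting sum only the square of the principal cofactor at `j` survives. -/
theorem IsCentred.detCof_of_ne (h : IsCentred p z μ₂ μ₃ μ₄) {n : ℕ}
    (hW : Fintype.card W = n + 2) {i j : W} (hij : i ≠ j) :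
    detCof p z W i j = μ₃ * detSqFin p z n := by
  obtain ⟨e, he⟩ := exists_equiv_option_fin hW i
  obtain ⟨j', hj'⟩ := exists_eq_some_of_ne e hij he
  rw [detCof_equiv p z e, he, hj', h.detCof_none_some, sum_eq_single j',
    h.cofCof_self_self (Fintype.card_fin _)]
  · exact fun k _ hk => h.cofCof_self_left hk
  · simp

/-- Removing the shared index replaces it by a sum over all `l` of smaller moments. Those with `l`
equal to `j` or `k` vanish by `cofCof_self_left`, the others by induction. -/
theorem IsCentred.cofCof_share (h : IsCentred p z μ₂ μ₃ μ₄) {i j k : W} (hij : i ≠ j)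
    (hik : i ≠ k) (hjk : j ≠ k) : cofCof p z W i j i k = 0 := by
  obtain ⟨n, hn⟩ := exists_card_eq_succ i
  induction n generalizing W with
  | zero =>
    have := Fintype.card_le_one_iff_subsingleton.1 hn.le
    exact absurd (Subsingleton.elim i j) hij
  | succ n ih =>
    obtain ⟨e, he⟩ := exists_equiv_option_fin hn i
    obtain ⟨j', hj'⟩ := exists_eq_some_of_ne e hij he
    obtain ⟨k', hk'⟩ := exists_eq_some_of_ne e hik he
    have hjk' : j' ≠ k' := by
      rintro rfl
      exact hjk (e.injective (hj'.trans hk'.symm))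
    rw [cofCof_equiv p z e, he, hj', hk', h.cofCof_none_some_none_some, sum_eq_zero, mul_zero]
    intro l _
    by_cases hlj : l = j'
    · subst hlj; exact h.cofCof_self_left hjk'
    · by_cases hlk : l = k'
      · subst hlk; rw [cofCof_swap]; exact h.cofCof_self_left hjk'.symm
      · exact ih hlj hlk hjk' (Fintype.card_fin _)

variable (p z) in
/-- The second moment of an off-diagonal cofactor of a symmetric matrix of size `n + 2`. -/
noncomputable def offDiagCofSq (n : ℕ) : ℝ :=
  cofCof p z (Option (Option (Fin n))) none (some none) none (some none)

variable (p z) in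
/-- The mixed moment of two principal cofactors of a symmetric matrix of size `n + 2`. -/
noncomputable def diagCofCof (n : ℕ) : ℝ :=
  cofCof p z (Option (Option (Fin n))) none none (some none) (some none)

theorem cofCof_offDiag {n : ℕ} (hW : Fintype.card W = n + 2) {i j : W} (hij : i ≠ j) :
    cofCof p z W i j i j = offDiagCofSq p z n := by
  obtain ⟨e, hi, hj⟩ := exists_equiv_option_fin₂ hW hij
  rw [cofCof_equiv p z e, hi, hj, offDiagCofSq]

theorem cofCof_diag {n : ℕ} (hW : Fintype.card W = n + 2) {i j : W} (hij : i ≠ j) :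
    cofCof p z W i i j j = diagCofCof p z n := by
  obtain ⟨e, hi, hj⟩ := exists_equiv_option_fin₂ hW hij
  rw [cofCof_equiv p z e, hi, hj, diagCofCof]

/-- The shift corresponding to multiplication of an exponential generating function by `t`. -/
def egfShift (u : ℕ → ℝ) (n : ℕ) : ℝ := n * u (n - 1)

theorem IsCentred.sum_cofCof_diag (h : IsCentred p z μ₂ μ₃ μ₄) {n : ℕ}
    (hW : Fintype.card W = n) : ∑ i, ∑ k, cofCof p z W i i k k =
      egfShift (detSqFin p z) n + egfShift (egfShift (diagCofCof p z)) n := by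
  have key : ∀ i : W, ∑ k, cofCof p z W i i k k =
      detSqFin p z (n - 1) + ((n - 1 : ℕ) : ℝ) * diagCofCof p z (n - 2) := fun i => by
    obtain ⟨m, hm⟩ := exists_card_eq_succ i
    obtain rfl : n = m + 1 := hW.symm.trans hm
    rw [← add_sum_erase _ _ (mem_univ i), h.cofCof_self_self hm, Nat.add_sub_cancel]
    congr 1
    -- For `m = 0` the subtraction truncates, but then no index other than `i` exists and the value
    -- is irrelevant. The same device recurs in the sums below.
    rw [sum_congr rfl (g := fun _ => diagCofCof p z (m + 1 - 2)), sum_const, nsmul_eq_mul,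
      card_erase_of_mem (mem_univ i), card_univ, hm, Nat.add_sub_cancel]
    intro k hk
    have hki := ne_of_mem_erase hk
    have h1 : 1 < Fintype.card W := Fintype.one_lt_card_iff.2 ⟨k, i, hki⟩
    obtain ⟨r, rfl⟩ : ∃ r, m = r + 1 := ⟨m - 1, by omega⟩
    exact cofCof_diag hm hki.symm
  simp_rw [key]
  rw [sum_const, card_univ, hW, nsmul_eq_mul]
  simp only [egfShift, Nat.sub_sub]
  ring

theorem IsCentred.sum_cofCof_offDiag (h : IsCentred p z μ₂ μ₃ μ₄) {n : ℕ}
    (hW : Fintype.card W = n + 1) (j : W) : ∑ i, cofCof p z W i j i j =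
      detSqFin p z n + egfShift (offDiagCofSq p z) n := by
  rw [← add_sum_erase _ _ (mem_univ j), h.cofCof_self_self hW]
  congr 1
  rw [sum_congr rfl (g := fun _ => offDiagCofSq p z (n - 1)), sum_const, nsmul_eq_mul,
    card_erase_of_mem (mem_univ j), card_univ, hW, Nat.add_sub_cancel, egfShift]
  intro k hk
  have hki := ne_of_mem_erase hk
  have h1 : 1 < Fintype.card W := Fintype.one_lt_card_iff.2 ⟨k, j, hki⟩
  obtain ⟨r, rfl⟩ : ∃ r, n = r + 1 := ⟨n - 1, by omega⟩
  exact cofCof_offDiag hW hki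

theorem IsCentred.sum_sum_cofCof_offDiag (h : IsCentred p z μ₂ μ₃ μ₄) {n : ℕ}
    (hW : Fintype.card W = n) : ∑ i, ∑ j, cofCof p z W i j i j =
      egfShift (detSqFin p z) n + egfShift (egfShift (offDiagCofSq p z)) n := by
  have key : ∀ j : W, ∑ i, cofCof p z W i j i j =
      detSqFin p z (n - 1) + egfShift (offDiagCofSq p z) (n - 1) := fun j => by
    obtain ⟨m, hm⟩ := exists_card_eq_succ j
    obtain rfl : n = m + 1 := hW.symm.trans hm
    exact h.sum_cofCof_offDiag hm j
  rw [sum_comm]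
  simp_rw [key]
  rw [sum_const, card_univ, hW, nsmul_eq_mul, mul_add]
  rfl

theorem IsCentred.sum_cofCof_self (h : IsCentred p z μ₂ μ₃ μ₄) {n : ℕ}
    (hW : Fintype.card W = n) : ∑ i, cofCof p z W i i i i =
      egfShift (detSqFin p z) n := by
  rw [sum_congr rfl (g := fun _ => detSqFin p z (n - 1)), sum_const, card_univ, hW,
    nsmul_eq_mul, egfShift]
  intro i _
  obtain ⟨m, hm⟩ := exists_card_eq_succ i
  obtain rfl : n = m + 1 := hW.symm.trans hm
  exact h.cofCof_self_self hm i

theorem IsCentred.detSq_zero (h : IsCentred p z μ₂ μ₃ μ₄) : detSqFin p z 0 = 1 := by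
  simp only [detSqFin, detSq, det_isEmpty, mul_one, symE]
  exact h.wexp_const 1

/-- The diagonal terms of the three pairings contribute 3μ₂² to the coefficient of n·a(n−1), which
cancels the −3μ₂² of the fourth cumulant and leaves `μ₄`. -/
theorem IsCentred.detSq_succ (h : IsCentred p z μ₂ μ₃ μ₄) (n : ℕ) :
    detSqFin p z (n + 1) = μ₂ * detSqFin p z n
      + μ₄ * egfShift (detSqFin p z) n
      + μ₂ ^ 2 * (egfShift (egfShift (diagCofCof p z)) n
        + 2 * egfShift (egfShift (offDiagCofSq p z)) n) := by
  rw [← detSq_of_card (W := Option (Fin n)) (by simp), h.detSq_option, ← detSqFin,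
    h.sum_cofCof_diag (Fintype.card_fin n), h.sum_sum_cofCof_offDiag (Fintype.card_fin n),
    h.sum_cofCof_self (Fintype.card_fin n)]
  ring

theorem IsCentred.offDiagCofSq_eq (h : IsCentred p z μ₂ μ₃ μ₄) (n : ℕ) :
    offDiagCofSq p z n = μ₂ * (detSqFin p z n + egfShift (offDiagCofSq p z) n) := by
  rw [offDiagCofSq, h.cofCof_none_some_none_some, h.sum_cofCof_offDiag (n := n) (by simp)]

/-- Both indices are removed in turn, each contributing −μ₂, which leaves the sum of all products of
two principal cofactors in size `n`. -/
theorem IsCentred.diagCofCof_eq (h : IsCentred p z μ₂ μ₃ μ₄) (n : ℕ) :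
    diagCofCof p z n = μ₂ ^ 2 *
      (egfShift (detSqFin p z) n + egfShift (egfShift (diagCofCof p z)) n) := by
  have key : ∀ j : Fin n, (symE p z (Option (Fin n)) fun Y =>
      Y.det * borderForm Y none none (some j) (some j)) =
      -μ₂ * ∑ i, cofCof p z (Fin n) i i j j := fun j => by
    have : (symE p z (Option (Fin n)) fun Y =>
      Y.det * borderForm Y none none (some j) (some j)) = symE p z (Fin n) fun Y =>
        -μ₂ * ∑ i, Y.adjugate i i * Y.adjugate j j := by
      refine h.symE_option_eq (c := fun Y => -Y.adjugate j j * (μ₂ * ∑ i, Y.adjugate i i))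
        (d := fun Y => Y.det * Y.adjugate j j) (e := 0) (fun Y hY a => ?_) fun Y hY => ?_
      · rw [← h.wexp_quad, ← wexp_const_mul, ← h.wexp_const (ι := Fin n) (a * (_ * _)),
          ← wexp_add, ← h.wexp_const (ι := Fin n) (a * a * _), ← wexp_add]
        congr! 2 with v
        rw [det_border, borderForm_border_some]
        simp
        ring
      · simp [← sum_mul]
        ring
    rw [this]
    simp only [symE_const_mul, symE_sum]
    rfl
  rw [diagCofCof, h.cofCof_none_none_some_some, Fintype.sum_option]
  simp_rw [key, borderForm_self', mul_zero]
  rw [← mul_sum, sum_comm, h.sum_cofCof_diag (Fintype.card_fin n)]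
  rw [show (symE p z (Option (Fin n)) fun _ => (0 : ℝ)) = 0 from h.wexp_const 0]
  ring

theorem borderForm_submatrix_equiv {U : Type*} [Fintype U] [DecidableEq U] {R : Type*} [CommRing R]
    (e : W ≃ U) (Y : Matrix U U R) (k l i j : W) :
    borderForm (Y.submatrix e e) k l i j = borderForm Y (e k) (e l) (e i) (e j) := by
  have : (Y.submatrix e e).updateRow l (Pi.single k 1) =
      (Y.updateRow (e l) (Pi.single (e k) 1)).submatrix e e := by
    ext a b
    by_cases ha : a = l
    · subst ha; simp [Pi.single_apply]
    · simp [ha]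
  simp only [borderForm, of_apply, this, adjugate_submatrix_equiv_self, submatrix_apply,
    e.injective.eq_iff]

theorem symE_adjugate_mul_borderForm_equiv {U : Type*} [Fintype U] [DecidableEq U]
    (e : W ≃ U) (i j k l : W) :
    (symE p z W fun Y => Y.adjugate i j * borderForm Y k l i i) =
      symE p z U fun Y => Y.adjugate (e i) (e j) * borderForm Y (e k) (e l) (e i) (e i) := by
  rw [symE_equiv p z e]
  simp only [borderForm_submatrix_equiv, adjugate_submatrix_equiv_self, submatrix_apply]

theorem IsCentred.symE_adjugate_mul_borderForm_self (h : IsCentred p z μ₂ μ₃ μ₄) (k l : W) :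
    (symE p z (Option W) fun Y =>
      Y.adjugate none none * borderForm Y (some k) (some l) none none) = detCof p z W k l := by
  refine h.symE_option_eq (c := fun Y => Y.det * Y.adjugate k l) (d := 0) (e := 0)
    (fun Y hY a => ?_) fun Y hY => by simp
  simp [adjugate_border_none_none, borderForm_border_none, h.wexp_const]

/-- Unless `i` is `k` or `l`, where the diagonal entry of the form vanishes, border at `i`: the
cofactor is linear in the border and the form entry does not involve it, so centring gives 0. -/
theorem IsCentred.symE_adjugate_mul_borderForm_of_ne (h : IsCentred p z μ₂ μ₃ μ₄)
    {i j k l : W} (hij : i ≠ j) :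
    (symE p z W fun Y => Y.adjugate i j * borderForm Y k l i i) = 0 := by
  have zero : (symE p z W fun _ => (0 : ℝ)) = 0 := h.wexp_const 0
  by_cases hil : i = l
  · subst hil
    simp [borderForm_self', zero]
  by_cases hik : i = k
  · subst hik
    simp [borderForm_self _ hil, zero]
  obtain ⟨n, hn⟩ := exists_card_eq_succ i
  obtain ⟨e, hi⟩ := exists_equiv_option_fin hn i
  obtain ⟨j', hj⟩ := exists_eq_some_of_ne e hij hi
  obtain ⟨k', hk⟩ := exists_eq_some_of_ne e hik hi
  obtain ⟨l', hl⟩ := exists_eq_some_of_ne e hil hi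
  rw [symE_adjugate_mul_borderForm_equiv e, hi, hj, hk, hl,
    show (0 : ℝ) = symE p z (Fin n) fun _ => 0 from (h.wexp_const 0).symm]
  refine h.symE_option_eq (c := 0) (d := 0) (e := 0) (fun Y hY a => ?_) fun Y hY => by simp
  simp only [adjugate_border_none_some, borderForm_border_none, wexp_mul_const, wexp_neg,
    h.wexp_lin]
  simp

/-- In the outer border the first cofactor is linear and the second quadratic, giving `μ₃` times a
sum over one index. Only its `none` term survives, and it reduces to a determinant times a cofactor
over `W`. -/
theorem IsCentred.cofCof_disjoint (h : IsCentred p z μ₂ μ₃ μ₄) (k l : W) :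
    cofCof p z (Option (Option W)) none (some none) (some (some k)) (some (some l)) =
      μ₃ * detCof p z W k l := by
  rw [h.cofCof_none_some_some_some, sum_eq_single none, h.symE_adjugate_mul_borderForm_self]
  · exact fun i _ hi => h.symE_adjugate_mul_borderForm_of_ne hi
  · simp

theorem IsCentred.exists_cofCof_disjoint (h : IsCentred p z μ₂ μ₃ μ₄) {n : ℕ}
    (hW : Fintype.card W = n + 2) {i j k l : W} (hij : i ≠ j) (hk : k ≠ i ∧ k ≠ j)
    (hl : l ≠ i ∧ l ≠ j) : ∃ k' l' : Fin n, (k' = l' ↔ k = l) ∧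
      cofCof p z W i j k l = μ₃ * detCof p z (Fin n) k' l' := by
  obtain ⟨e, hi, hj⟩ := exists_equiv_option_fin₂ hW hij
  have lift : ∀ x : W, x ≠ i ∧ x ≠ j → ∃ x', e x = some (some x') := fun x hx => by
    obtain ⟨x', hx'⟩ := exists_eq_some_of_ne e hx.1.symm hi
    obtain ⟨x'', hx''⟩ : ∃ y, x' = some y := by
      rw [← Option.ne_none_iff_exists']
      rintro rfl
      exact hx.2 (e.injective (hx'.trans hj.symm))
    exact ⟨x'', by rw [hx', hx'']⟩
  obtain ⟨k', hk'⟩ := lift k hk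
  obtain ⟨l', hl'⟩ := lift l hl
  refine ⟨k', l', ?_, ?_⟩
  · rw [← e.injective.eq_iff, hk', hl']; simp
  · rw [cofCof_equiv p z e, hi, hj, hk', hl', h.cofCof_disjoint]

theorem IsCentred.cofCof_off_diag (h : IsCentred p z μ₂ μ₃ μ₄) {i j k : W} (hij : i ≠ j)
    (hk : k ≠ i ∧ k ≠ j) : cofCof p z W i j k k = 0 := by
  obtain ⟨n, hn⟩ : ∃ n, Fintype.card W = n + 2 :=
    ⟨Fintype.card W - 2, by have := Fintype.one_lt_card_iff.2 ⟨i, j, hij⟩; omega⟩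
  obtain ⟨k', l', hkl, hc⟩ := h.exists_cofCof_disjoint hn hij hk hk
  rw [hc, hkl.2 rfl, h.detCof_self, mul_zero]

theorem IsCentred.cofCof_off_off (h : IsCentred p z μ₂ μ₃ μ₄) {n : ℕ}
    (hW : Fintype.card W = n + 4) {i j k l : W} (hij : i ≠ j) (hk : k ≠ i ∧ k ≠ j)
    (hl : l ≠ i ∧ l ≠ j) (hkl : k ≠ l) : cofCof p z W i j k l = μ₃ ^ 2 * detSqFin p z n := by
  obtain ⟨k', l', hkl', hc⟩ := h.exists_cofCof_disjoint (n := n + 2) hW hij hk hl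
  rw [hc, h.detCof_of_ne (Fintype.card_fin _) (fun e => hkl (hkl'.1 e)), sq, mul_assoc]

/-! ### Sums over all cofactors -/

theorem IsCentred.sum_detCof (h : IsCentred p z μ₂ μ₃ μ₄) {n : ℕ} (hW : Fintype.card W = n) :
    ∑ i, ∑ j, detCof p z W i j =
      μ₃ * egfShift (egfShift (detSqFin p z)) n := by
  have key : ∀ i : W, ∑ j, detCof p z W i j =
      ((n - 1 : ℕ) : ℝ) * (μ₃ * detSqFin p z (n - 2)) := fun i => by
    obtain ⟨m, hm⟩ := exists_card_eq_succ i
    obtain rfl : n = m + 1 := hW.symm.trans hm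
    rw [← add_sum_erase _ _ (mem_univ i), h.detCof_self, zero_add,
      sum_congr rfl (g := fun _ => μ₃ * detSqFin p z (m + 1 - 2)), sum_const, nsmul_eq_mul,
      card_erase_of_mem (mem_univ i), card_univ, hm]
    intro k hk
    have hki := ne_of_mem_erase hk
    have h1 : 1 < Fintype.card W := Fintype.one_lt_card_iff.2 ⟨k, i, hki⟩
    obtain ⟨r, rfl⟩ : ∃ r, m = r + 1 := ⟨m - 1, by omega⟩
    exact h.detCof_of_ne hm hki.symm
  simp_rw [key]
  rw [sum_const, card_univ, hW, nsmul_eq_mul]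
  simp only [egfShift, Nat.sub_sub]
  ring

theorem IsCentred.sum_cofCof_of_diag (h : IsCentred p z μ₂ μ₃ μ₄) (i : W) :
    ∑ k, ∑ l, cofCof p z W i i k l = ∑ k, cofCof p z W i i k k := by
  refine sum_congr rfl fun k _ => sum_eq_single k (fun l _ hl => ?_) (by simp)
  rw [cofCof_swap]
  by_cases hik : i = k
  · subst hik
    rw [cofCof_swap, h.cofCof_self_left hl.symm]
  · by_cases hil : i = l
    · subst hil
      rw [cofCof_symm_left, cofCof_swap, h.cofCof_self_left hl]
    · exact h.cofCof_off_diag hl.symm ⟨hik, hil⟩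

/-- The pairs (i, j) and (j, i) give the two off-diagonal squares. The n(n−1) ordered pairs of
distinct indices outside {i, j} give the `μ₃ ^ 2` term; all other pairs contribute 0. -/
theorem IsCentred.sum_cofCof_of_ne (h : IsCentred p z μ₂ μ₃ μ₄) {n : ℕ}
    (hW : Fintype.card W = n + 2) {i j : W} (hij : i ≠ j) :
    ∑ k, ∑ l, cofCof p z W i j k l = 2 * offDiagCofSq p z n
      + μ₃ ^ 2 * egfShift (egfShift (detSqFin p z)) n := by
  set s : Finset W := (univ.erase i).erase j with hs
  have hcard : s.card = n := by
    rw [hs, card_erase_of_mem (by simp [hij.symm]), card_erase_of_mem (mem_univ i), card_univ, hW]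
    omega
  have split : ∀ f : W → ℝ, ∑ k, f k = f i + (f j + ∑ k ∈ s, f k) := fun f => by
    rw [hs, add_sum_erase _ _ (by simp [hij.symm] : j ∈ univ.erase i),
      add_sum_erase _ _ (mem_univ i)]
  have mem : ∀ k ∈ s, k ≠ i ∧ k ≠ j := fun k hk => by
    rw [hs] at hk; exact ⟨ne_of_mem_erase (mem_of_mem_erase hk), ne_of_mem_erase hk⟩
  have hi : ∑ l, cofCof p z W i j i l = offDiagCofSq p z n := by
    rw [sum_eq_single j, cofCof_offDiag hW hij]
    · intro l _ hl
      by_cases hil : i = l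
      · subst hil; rw [cofCof_swap, h.cofCof_self_left hij]
      · exact h.cofCof_share hij hil hl.symm
    · simp
  have hj : ∑ l, cofCof p z W i j j l = offDiagCofSq p z n := by
    rw [sum_eq_single i, cofCof_symm_left, cofCof_offDiag hW hij.symm]
    · intro l _ hl
      rw [cofCof_symm_left]
      by_cases hjl : j = l
      · subst hjl; rw [cofCof_swap, h.cofCof_self_left hij.symm]
      · exact h.cofCof_share hij.symm hjl hl.symm
    · simp
  have hk : ∀ k ∈ s, ∑ l, cofCof p z W i j k l =
      ((n - 1 : ℕ) : ℝ) * (μ₃ ^ 2 * detSqFin p z (n - 2)) := fun k hks => by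
    obtain ⟨hki, hkj⟩ := mem k hks
    have e1 : cofCof p z W i j k i = 0 := by
      rw [cofCof_symm_right]; exact h.cofCof_share hij hki.symm hkj.symm
    have e2 : cofCof p z W i j k j = 0 := by
      rw [cofCof_symm_right, cofCof_symm_left]; exact h.cofCof_share hij.symm hkj.symm hki.symm
    rw [split, e1, e2, ← add_sum_erase _ _ hks, h.cofCof_off_diag hij ⟨hki, hkj⟩,
      sum_congr rfl (g := fun _ => μ₃ ^ 2 * detSqFin p z (n - 2)), sum_const, nsmul_eq_mul,
      card_erase_of_mem hks, hcard]
    · ring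
    intro l hl
    have hls := mem_of_mem_erase hl
    have h2 : 1 < s.card := one_lt_card.2 ⟨l, hls, k, hks, ne_of_mem_erase hl⟩
    obtain ⟨r, rfl⟩ : ∃ r, n = r + 2 := ⟨n - 2, by omega⟩
    exact h.cofCof_off_off hW hij ⟨hki, hkj⟩ (mem l hls) (ne_of_mem_erase hl).symm
  rw [split, hi, hj, sum_congr rfl hk, sum_const, hcard, nsmul_eq_mul]
  simp only [egfShift, Nat.sub_sub]
  ring

theorem IsCentred.sum_cofCof (h : IsCentred p z μ₂ μ₃ μ₄) {n : ℕ} (hW : Fintype.card W = n) :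
    ∑ i, ∑ j, ∑ k, ∑ l, cofCof p z W i j k l =
      egfShift (detSqFin p z) n + egfShift (egfShift (diagCofCof p z)) n
      + 2 * egfShift (egfShift (offDiagCofSq p z)) n
      + μ₃ ^ 2 * egfShift (egfShift (egfShift (egfShift (detSqFin p z)))) n := by
  have key : ∀ i : W, ∑ j, ∑ k, ∑ l, cofCof p z W i j k l =
      ∑ k, cofCof p z W i i k k + ((n - 1 : ℕ) : ℝ) * (2 * offDiagCofSq p z (n - 2)
        + μ₃ ^ 2 * egfShift (egfShift (detSqFin p z)) (n - 2)) := fun i => by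
    obtain ⟨m, hm⟩ := exists_card_eq_succ i
    obtain rfl : n = m + 1 := hW.symm.trans hm
    rw [← add_sum_erase _ _ (mem_univ i), h.sum_cofCof_of_diag,
      sum_congr (s₁ := univ.erase i) rfl (g := fun _ => 2 * offDiagCofSq p z (m + 1 - 2)
        + μ₃ ^ 2 * egfShift (egfShift (detSqFin p z)) (m + 1 - 2)), sum_const,
      nsmul_eq_mul, card_erase_of_mem (mem_univ i), card_univ, hm]
    intro k hk
    have hki := ne_of_mem_erase hk
    have h1 : 1 < Fintype.card W := Fintype.one_lt_card_iff.2 ⟨k, i, hki⟩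
    obtain ⟨r, rfl⟩ : ∃ r, m = r + 1 := ⟨m - 1, by omega⟩
    exact h.sum_cofCof_of_ne hm hki.symm
  simp_rw [key, sum_add_distrib]
  rw [h.sum_cofCof_diag hW, sum_const, card_univ, hW, nsmul_eq_mul]
  simp only [egfShift, Nat.sub_sub]
  ring

/-- The second moment of the determinant after shifting every entry by `m`. -/
theorem IsCentred.symE_det_add_const_sq (h : IsCentred p z μ₂ μ₃ μ₄) (m : ℝ) (n : ℕ) :
    (symE p z (Fin n) fun Y => (Y + of fun _ _ => m).det ^ 2) =
      detSqFin p z n + 2 * m * μ₃ * egfShift (egfShift (detSqFin p z)) n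
      + m ^ 2 * (egfShift (detSqFin p z) n
        + egfShift (egfShift (diagCofCof p z)) n
        + 2 * egfShift (egfShift (offDiagCofSq p z)) n
        + μ₃ ^ 2 * egfShift (egfShift (egfShift (egfShift (detSqFin p z)))) n) := by
  have expand : ∀ Y : Matrix (Fin n) (Fin n) ℝ, (Y + of fun _ _ => m).det ^ 2 =
      Y.det * Y.det + 2 * m * ∑ i, ∑ j, Y.det * Y.adjugate i j
      + m ^ 2 * ∑ i, ∑ j, ∑ k, ∑ l, Y.adjugate i j * Y.adjugate k l := fun Y => by
    rw [det_add_const]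
    simp only [← mul_sum, ← sum_mul]
    ring
  simp_rw [expand, symE_add, symE_const_mul, symE_sum]
  rw [← h.sum_cofCof (Fintype.card_fin n), mul_assoc (2 * m), ← h.sum_detCof (Fintype.card_fin n)]
  rfl

end Recursion

/-! ### Reduction to finite expectations -/

section Expansion

variable {V : Type*} [Fintype V] [DecidableEq V]

/-- The number of times the entry `e` occurs in the Leibniz term of `σ`. -/
def leibnizDegree (σ : Equiv.Perm V) (e : Sym2 V) : ℕ := #{i | s(σ i, i) = e}

/-- The entry {a, b} can only be picked in columns `a` and `b`. This is what makes a finite fourth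
moment sufficient. -/
theorem leibnizDegree_le_two (σ : Equiv.Perm V) (e : Sym2 V) : leibnizDegree σ e ≤ 2 := by
  induction e with
  | _ a b =>
    refine (card_le_card (t := {a, b}) fun i hi => ?_).trans card_le_two
    simp only [mem_filter, mem_univ, true_and, Sym2.eq_iff] at hi
    simp only [mem_insert, mem_singleton]
    tauto

theorem det_symmetric_sq (y : Sym2 V → ℝ) :
    (of fun i j => y s(i, j)).det ^ 2 = ∑ σ : Equiv.Perm V, ∑ τ : Equiv.Perm V,
      ((Equiv.Perm.sign σ : ℤ) * (Equiv.Perm.sign τ : ℤ) : ℝ)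
        * ∏ e, y e ^ (leibnizDegree σ e + leibnizDegree τ e) := by
  have term : ∀ σ : Equiv.Perm V,
      ∏ i, y s(σ i, i) = ∏ e, y e ^ leibnizDegree σ e := fun σ => by
    rw [← Finset.prod_fiberwise' univ (fun i => s(σ i, i)) y]
    exact prod_congr rfl fun e _ => by rw [prod_const, leibnizDegree]
  rw [sq, det_apply', sum_mul_sum]
  simp only [of_apply, term, pow_add, prod_mul_distrib]
  exact sum_congr rfl fun σ _ => sum_congr rfl fun τ _ => by ring

end Expansion

section Quadrature

variable {ρ : Measure ℝ} [IsProbabilityMeasure ρ]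

theorem integrable_pow_of_memLp_four (hρ : MemLp (id : ℝ → ℝ) 4 ρ) {k : ℕ} (hk : k ≤ 4) :
    Integrable (fun x => x ^ k) ρ := by
  rcases Nat.eq_zero_or_pos k with rfl | hk0
  · simp
  have h : MemLp (id : ℝ → ℝ) (k : ENNReal) ρ :=
    hρ.mono_exponent (by exact_mod_cast hk)
  exact (integrable_norm_iff (by fun_prop)).1 (by simpa using h.integrable_norm_pow hk0.ne')

theorem integrable_eval_of_memLp_four (hρ : MemLp (id : ℝ → ℝ) 4 ρ) {q : Polynomial ℝ}
    (hq : q.natDegree ≤ 4) : Integrable (fun x => q.eval x) ρ := by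
  simp only [Polynomial.eval_eq_sum_range]
  refine integrable_finsetSum _ fun k hk => (integrable_pow_of_memLp_four hρ ?_).const_mul _
  have := mem_range.1 hk
  omega

/-- A polynomial of degree at most 4 equals its Lagrange interpolant at five nodes, so the weights
are the integrals of the basis polynomials. They may be negative, and any distinct nodes would do.
-/
theorem exists_quadrature (hρ : MemLp (id : ℝ → ℝ) 4 ρ) (m : ℝ) :
    ∃ p z : Fin 5 → ℝ, ∀ q : Polynomial ℝ, q.natDegree ≤ 4 →
      ∫ x, q.eval x ∂ρ = ∑ i, p i * q.eval (z i + m) := by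
  have inj : Set.InjOn (fun i : Fin 5 => (i : ℝ) + m) (univ : Finset (Fin 5)) := by
    intro a _ b _ h
    simpa [Fin.ext_iff] using h
  set v : Fin 5 → ℝ := fun i => (i : ℝ) + m
  refine ⟨fun i => ∫ x, (Lagrange.basis univ v i).eval x ∂ρ, fun i => (i : ℝ), fun q hq => ?_⟩
  have hdeg : q.degree < #(univ : Finset (Fin 5)) :=
    lt_of_le_of_lt Polynomial.degree_le_natDegree (by
      rw [card_univ, Fintype.card_fin]; exact_mod_cast Nat.lt_succ_of_le hq)
  have hx : ∀ x, q.eval x = ∑ i, q.eval (v i) * (Lagrange.basis univ v i).eval x := fun x => by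
    conv_lhs => rw [Lagrange.eq_interpolate inj hdeg, Lagrange.interpolate_apply]
    simp [Polynomial.eval_finsetSum]
  rw [integral_congr_ae (ae_of_all _ hx), integral_finsetSum]
  · exact sum_congr rfl fun i _ => by rw [integral_const_mul, mul_comm]
  · refine fun i _ => (integrable_eval_of_memLp_four hρ ?_).const_mul _
    rw [Lagrange.natDegree_basis inj (mem_univ i)]
    simp

end Quadrature

/-! ### From the random matrix to finite expectations. -/

section Transfer

variable {ρ : Measure ℝ} {Ω : Type*} [MeasurableSpace Ω] {P : Measure Ω}
  {n : ℕ} {X : Ω → Matrix (Fin n) (Fin n) ℝ}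

theorem IsIIDSymmetric.hasLaw_entries (hX : IsIIDSymmetric ρ P X) :
    HasLaw (fun ω (e : Sym2 (Fin n)) => X ω e.inf e.sup) (Measure.pi fun _ => ρ) P :=
  iIndepFun.hasLaw_pi (fun e => hX.hasLaw _ _ (Sym2.inf_le_sup e))
    (hX.indep.precomp Sym2.sortEquiv.injective)

theorem IsIIDSymmetric.eq_of_entries (hX : IsIIDSymmetric ρ P X) (ω : Ω) :
    X ω = of fun i j => (fun e : Sym2 (Fin n) => X ω e.inf e.sup) s(i, j) := by
  ext i j
  rcases le_total i j with h | h
  · simp [h]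
  · simp [h, (hX.symm ω).apply]

variable [IsProbabilityMeasure ρ]

theorem integrable_det_symmetric_sq (hρ : MemLp (id : ℝ → ℝ) 4 ρ) (n : ℕ) :
    Integrable (fun y : Sym2 (Fin n) → ℝ => (of fun i j => y s(i, j)).det ^ 2)
      (Measure.pi fun _ => ρ) := by
  simp only [det_symmetric_sq]
  refine integrable_finsetSum _ fun σ _ => integrable_finsetSum _ fun τ _ =>
    Integrable.const_mul (Integrable.fintype_prod (μ := fun _ => ρ)
      (f := fun e x => x ^ (leibnizDegree σ e + leibnizDegree τ e)) fun e =>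
        integrable_pow_of_memLp_four hρ ?_) _
  have := leibnizDegree_le_two σ e
  have := leibnizDegree_le_two τ e
  omega

theorem IsIIDSymmetric.integrable_det_sq (hX : IsIIDSymmetric ρ P X)
    (hρ : MemLp (id : ℝ → ℝ) 4 ρ) : Integrable (fun ω => (X ω).det ^ 2) P := by
  have h := integrable_det_symmetric_sq hρ n
  rw [← hX.hasLaw_entries.map_eq] at h
  have h2 := h.comp_aemeasurable hX.hasLaw_entries.aemeasurable
  refine h2.congr (ae_of_all _ fun ω => ?_)
  exact congrArg (fun M : Matrix (Fin n) (Fin n) ℝ => M.det ^ 2) (hX.eq_of_entries ω).symm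

theorem IsIIDSymmetric.detMoment_two_eq_symE (hX : IsIIDSymmetric ρ P X)
    (hρ : MemLp (id : ℝ → ℝ) 4 ρ) {K : Type*} [Fintype K] {p z : K → ℝ} {m : ℝ}
    (hp : ∀ q : Polynomial ℝ, q.natDegree ≤ 4 →
      ∫ x, q.eval x ∂ρ = ∑ i, p i * q.eval (z i + m)) :
    detMoment 2 P X = symE p z (Fin n) fun Y => (Y + of fun _ _ => m).det ^ 2 := by
  have h1 : detMoment 2 P X = ∫ y : Sym2 (Fin n) → ℝ, (of fun i j => y s(i, j)).det ^ 2
      ∂(Measure.pi fun _ => ρ) := by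
    rw [← hX.hasLaw_entries.integral_comp (integrable_det_symmetric_sq hρ n).aestronglyMeasurable,
      detMoment]
    congr 1
    ext ω
    exact congrArg (fun M : Matrix (Fin n) (Fin n) ℝ => M.det ^ 2) (hX.eq_of_entries ω)
  have hdeg : ∀ (σ τ : Equiv.Perm (Fin n)) (e : Sym2 (Fin n)),
      leibnizDegree σ e + leibnizDegree τ e ≤ 4 := fun σ τ e => by
    have := leibnizDegree_le_two σ e
    have := leibnizDegree_le_two τ e
    omega
  have h2 : (symE p z (Fin n) fun Y => (Y + of fun _ _ => m).det ^ 2) =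
      ∑ σ : Equiv.Perm (Fin n), ∑ τ : Equiv.Perm (Fin n),
        ((Equiv.Perm.sign σ : ℤ) * (Equiv.Perm.sign τ : ℤ) : ℝ)
          * wexp p z fun y : Sym2 (Fin n) → ℝ =>
            ∏ e, (y e + m) ^ (leibnizDegree σ e + leibnizDegree τ e) := by
    simp_rw [← wexp_const_mul, ← wexp_sum]
    exact congrArg (wexp p z) (funext fun y => det_symmetric_sq fun e => y e + m)
  rw [h1, h2]
  simp only [det_symmetric_sq]
  rw [integral_finsetSum]
  swap
  · exact fun σ _ => integrable_finsetSum _ fun τ _ =>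
      Integrable.const_mul (Integrable.fintype_prod (μ := fun _ => ρ)
        (f := fun e x => x ^ (leibnizDegree σ e + leibnizDegree τ e)) fun e =>
          integrable_pow_of_memLp_four hρ (hdeg σ τ e)) _
  refine sum_congr rfl fun σ _ => ?_
  rw [integral_finsetSum]
  swap
  · exact fun τ _ => Integrable.const_mul (Integrable.fintype_prod (μ := fun _ => ρ)
        (f := fun e x => x ^ (leibnizDegree σ e + leibnizDegree τ e)) fun e =>
          integrable_pow_of_memLp_four hρ (hdeg σ τ e)) _
  refine sum_congr rfl fun τ _ => ?_
  rw [integral_const_mul, integral_fintype_prod_eq_prod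
    (f := fun (e : Sym2 (Fin n)) (x : ℝ) => x ^ (leibnizDegree σ e + leibnizDegree τ e)),
    wexp_prod p z fun e t => (t + m) ^ (leibnizDegree σ e + leibnizDegree τ e)]
  congr 1
  refine prod_congr rfl fun e _ => ?_
  have := hp (Polynomial.X ^ (leibnizDegree σ e + leibnizDegree τ e))
    ((Polynomial.natDegree_X_pow_le _).trans (hdeg σ τ e))
  simpa using this

theorem isCentred_of_quadrature {K : Type*} [Fintype K] {p z : K → ℝ}
    (hp : ∀ q : Polynomial ℝ, q.natDegree ≤ 4 →
      ∫ x, q.eval x ∂ρ = ∑ i, p i * q.eval (z i + ∫ x, x ∂ρ)) (hρ : MemLp (id : ℝ → ℝ) 4 ρ) :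
    IsCentred p z (centralMoment id 2 ρ) (centralMoment id 3 ρ) (centralMoment id 4 ρ) := by
  have key : ∀ k ≤ 4, wmoment p z k = ∫ x, (x - ∫ x, x ∂ρ) ^ k ∂ρ := fun k hk => by
    have := hp ((Polynomial.X - Polynomial.C (∫ x, x ∂ρ)) ^ k) (by simpa using hk)
    simpa [wmoment] using this.symm
  have cen : ∀ k, centralMoment id k ρ = ∫ x, (x - ∫ x, x ∂ρ) ^ k ∂ρ := fun k => by
    simp [centralMoment]
  refine ⟨by simp [key], ?_, ?_, ?_, ?_⟩
  · rw [key 1 (by norm_num)]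
    have hi : Integrable (fun x : ℝ => x) ρ := by
      simpa using integrable_pow_of_memLp_four hρ (k := 1) (by norm_num)
    simp [integral_sub hi (integrable_const _)]
  all_goals rw [key _ (by norm_num), cen]

end Transfer

/-! ### Exponential generating functions -/

section ExponentialSeries

/-- The `n`-th term of the exponential generating function of `u` at `t`. -/
noncomputable def egfTerm (t : ℝ) (u : ℕ → ℝ) (n : ℕ) : ℝ := u n * (t ^ n / (n.factorial : ℝ))

theorem egfTerm_egfShift_zero (t : ℝ) (u : ℕ → ℝ) : egfTerm t (egfShift u) 0 = 0 := by
  simp [egfTerm, egfShift]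

theorem egfTerm_egfShift_succ (t : ℝ) (u : ℕ → ℝ) (n : ℕ) :
    egfTerm t (egfShift u) (n + 1) = t * egfTerm t u n := by
  simp only [egfTerm, egfShift, Nat.add_sub_cancel, Nat.factorial_succ]
  push_cast
  have : (n.factorial : ℝ) ≠ 0 := by positivity
  field_simp
  ring

theorem HasSum.egfShift {t U : ℝ} {u : ℕ → ℝ} (h : HasSum (egfTerm t u) U) :
    HasSum (egfTerm t (egfShift u)) (t * U) := by
  rw [← hasSum_nat_add_iff' 1]
  simpa [egfTerm_egfShift_zero, egfTerm_egfShift_succ] using h.mul_left t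

theorem abs_egfTerm_egfShift_le {r C : ℝ} (hr : 0 ≤ r) (hC : 0 ≤ C) {u : ℕ → ℝ} {n : ℕ}
    (h : ∀ k < n, |egfTerm r u k| ≤ C) : |egfTerm r (egfShift u) n| ≤ r * C := by
  rcases n with _ | n
  · rw [egfTerm_egfShift_zero, abs_zero]; positivity
  · rw [egfTerm_egfShift_succ, abs_mul, abs_of_nonneg hr]
    exact mul_le_mul_of_nonneg_left (h n n.lt_succ_self) hr

/-- Comparison with a geometric series of ratio |t|/r. -/
theorem summable_egfTerm_of_bounded {r t K : ℝ} (ht : |t| < r) {u : ℕ → ℝ}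
    (h : ∀ n, |egfTerm r u n| ≤ K) : Summable (egfTerm t u) := by
  have hr : 0 < r := (abs_nonneg t).trans_lt ht
  have hs : Summable fun n : ℕ => K * (|t| / r) ^ n :=
    (summable_geometric_of_lt_one (by positivity) ((div_lt_one hr).2 ht)).mul_left K
  refine Summable.of_norm_bounded hs fun n => ?_
  have : egfTerm t u n = egfTerm r u n * (t / r) ^ n := by
    simp only [egfTerm, div_pow]
    field_simp
  rw [this, norm_mul, norm_pow, norm_div, Real.norm_eq_abs, Real.norm_eq_abs, Real.norm_eq_abs,
    abs_of_pos hr]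
  exact mul_le_mul_of_nonneg_right (h n) (by positivity)

theorem abs_egfTerm_le_of_abs_le {r t : ℝ} (ht : |t| ≤ r) (u : ℕ → ℝ) (n : ℕ) :
    |egfTerm t u n| ≤ |egfTerm r u n| := by
  have hr : 0 ≤ r := (abs_nonneg t).trans ht
  simp only [egfTerm, abs_mul, abs_div, abs_pow, abs_of_nonneg hr]
  gcongr

/-- Term-by-term differentiation of an exponential generating function. -/
theorem hasDerivAt_tsum_egfTerm {r t : ℝ} (ht : |t| < r) {u : ℕ → ℝ} (hu : Summable (egfTerm t u))
    (hu' : Summable (egfTerm r fun n => u (n + 1))) :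
    HasDerivAt (fun s => ∑' n, egfTerm s u n) (∑' n, egfTerm t (fun n => u (n + 1)) n) t := by
  set g' : ℕ → ℝ → ℝ := fun n s => n.casesOn 0 fun k => egfTerm s (fun n => u (n + 1)) k with hg'
  have hder : ∀ n s, HasDerivAt (fun s => egfTerm s u n) (g' n s) s := by
    rintro (_ | n) s
    · simpa [egfTerm, hg'] using hasDerivAt_const s (u 0)
    · have := ((hasDerivAt_pow (n + 1) s).div_const ((n + 1).factorial : ℝ)).const_mul (u (n + 1))
      refine this.congr_deriv ?_
      simp only [hg', egfTerm, Nat.factorial_succ, Nat.add_sub_cancel]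
      push_cast
      have : (n.factorial : ℝ) ≠ 0 := by positivity
      field_simp
  have hsum : Summable fun n : ℕ => |g' n r| := by
    rw [← summable_nat_add_iff 1]
    exact hu'.abs
  have htsum : ∑' n, g' n t = ∑' n, egfTerm t (fun n => u (n + 1)) n := by
    have hs : Summable fun n => g' n t := by
      rw [← summable_nat_add_iff 1]
      exact Summable.of_norm_bounded hu'.abs fun n => abs_egfTerm_le_of_abs_le ht.le _ n
    rw [hs.tsum_eq_zero_add]
    simp [hg']
  rw [← htsum]
  refine hasDerivAt_tsum_of_isPreconnected (t := Metric.ball 0 r) (y₀ := t) hsum Metric.isOpen_ball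
    (convex_ball 0 r).isPreconnected (fun n s _ => hder n s) (fun n s hs => ?_)
    (by simpa using ht) hu (by simpa using ht)
  have hs' : |s| < r := by simpa using hs
  rcases n with _ | n
  · simp [hg']
  · exact abs_egfTerm_le_of_abs_le hs'.le _ n

end ExponentialSeries

/-! ### Convergence and solution of the recursion. -/

section Solution

/-- The recursion satisfied by the second moments `a` of the determinant, and by the second
moments `β` of off-diagonal and `γ` of principal cofactors. -/
structure DetMomentRecursion (μ₂ μ₄ : ℝ) (a β γ : ℕ → ℝ) : Prop where
  zero : a 0 = 1
  succ : ∀ n, a (n + 1) = μ₂ * a n + μ₄ * egfShift a n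
    + μ₂ ^ 2 * (egfShift (egfShift γ) n + 2 * egfShift (egfShift β) n)
  offDiag : ∀ n, β n = μ₂ * (a n + egfShift β n)
  diag : ∀ n, γ n = μ₂ ^ 2 * (egfShift a n + egfShift (egfShift γ) n)

variable {μ₂ μ₄ : ℝ} {a β γ : ℕ → ℝ}

/-- The constant is the fixed point B = |μ₂|(K + rB) of the recursion for `β`, so strong induction
reproduces it. `abs_diag_le` does the same for `γ`. -/
theorem DetMomentRecursion.abs_offDiag_le (H : DetMomentRecursion μ₂ μ₄ a β γ) {r K : ℝ}
    (hr : 0 ≤ r) (hq : |μ₂| * r < 1) (hK : 0 ≤ K) (n : ℕ)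
    (h : ∀ k ≤ n, |egfTerm r a k| ≤ K) : |egfTerm r β n| ≤ |μ₂| / (1 - |μ₂| * r) * K := by
  have hq' : 0 < 1 - |μ₂| * r := by linarith
  induction n using Nat.strong_induction_on with
  | _ n ih =>
    have e : egfTerm r β n = μ₂ * (egfTerm r a n + egfTerm r (egfShift β) n) := by
      simp only [egfTerm, H.offDiag n]; ring
    have h1 := abs_egfTerm_egfShift_le hr (by positivity)
      fun k hk => ih k hk fun j hj => h j (hj.trans hk.le)
    calc |egfTerm r β n| ≤ |μ₂| * (|egfTerm r a n| + |egfTerm r (egfShift β) n|) := by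
          rw [e, abs_mul]; gcongr; exact abs_add_le _ _
      _ ≤ |μ₂| * (K + r * (|μ₂| / (1 - |μ₂| * r) * K)) := by gcongr; exact h n le_rfl
      _ = _ := by field_simp; ring

theorem DetMomentRecursion.abs_diag_le (H : DetMomentRecursion μ₂ μ₄ a β γ) {r K : ℝ}
    (hr : 0 ≤ r) (hq : |μ₂| * r < 1) (hK : 0 ≤ K) (n : ℕ)
    (h : ∀ k ≤ n, |egfTerm r a k| ≤ K) :
    |egfTerm r γ n| ≤ μ₂ ^ 2 * r / (1 - μ₂ ^ 2 * r ^ 2) * K := by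
  have hq' : 0 < 1 - μ₂ ^ 2 * r ^ 2 := by
    have : (|μ₂| * r) ^ 2 < 1 := by
      rw [sq_lt_one_iff₀ (by positivity)]; exact hq
    rw [mul_pow, sq_abs] at this
    linarith
  induction n using Nat.strong_induction_on with
  | _ n ih =>
    have e : egfTerm r γ n =
        μ₂ ^ 2 * (egfTerm r (egfShift a) n + egfTerm r (egfShift (egfShift γ)) n) := by
      simp only [egfTerm, H.diag n]; ring
    have h0 := abs_egfTerm_egfShift_le (n := n) hr hK fun k hk => h k hk.le
    have h1 := abs_egfTerm_egfShift_le (n := n) hr (by positivity) fun k hk =>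
      abs_egfTerm_egfShift_le hr (by positivity)
        fun j hj => ih j (hj.trans hk) fun i hi => h i (hi.trans (hj.trans hk).le)
    calc |egfTerm r γ n| ≤ μ₂ ^ 2 *
          (|egfTerm r (egfShift a) n| + |egfTerm r (egfShift (egfShift γ)) n|) := by
          rw [e, abs_mul, abs_of_nonneg (sq_nonneg μ₂)]; gcongr; exact abs_add_le _ _
      _ ≤ μ₂ ^ 2 * (r * K + r * (r * (μ₂ ^ 2 * r / (1 - μ₂ ^ 2 * r ^ 2) * K))) := by gcongr
      _ = _ := by field_simp; ring

/-- The recursion gives (n+1)|term n+1| ≤ CK whenever `K` bounds the terms up to n, with `C`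
independent of n and `K`. Once n+1 ≥ C the bound `K` propagates unchanged. -/
theorem DetMomentRecursion.exists_bound (H : DetMomentRecursion μ₂ μ₄ a β γ) {r : ℝ}
    (hr : 0 ≤ r) (hq : |μ₂| * r < 1) : ∃ K, 0 ≤ K ∧ ∀ n, |egfTerm r a n| ≤ K := by
  set c := |μ₂| / (1 - |μ₂| * r) with hc
  set d := μ₂ ^ 2 * r / (1 - μ₂ ^ 2 * r ^ 2) with hd
  have hc0 : 0 ≤ c := div_nonneg (abs_nonneg _) (by linarith)
  have hd0 : 0 ≤ d := by
    refine div_nonneg (by positivity) ?_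
    have : (|μ₂| * r) ^ 2 < 1 := by
      rw [sq_lt_one_iff₀ (by positivity)]; exact hq
    rw [mul_pow, sq_abs] at this
    linarith
  set C := r * (|μ₂| + |μ₄| * r + μ₂ ^ 2 * (r * (r * d) + 2 * (r * (r * c)))) with hC
  have step : ∀ K, 0 ≤ K → ∀ n, (∀ k ≤ n, |egfTerm r a k| ≤ K) →
      (n + 1) * |egfTerm r a (n + 1)| ≤ C * K := by
    intro K hK n h
    have e : (n + 1) * egfTerm r a (n + 1) = r * (μ₂ * egfTerm r a n
        + μ₄ * egfTerm r (egfShift a) n + μ₂ ^ 2 * (egfTerm r (egfShift (egfShift γ)) n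
          + 2 * egfTerm r (egfShift (egfShift β)) n)) := by
      have : (n.factorial : ℝ) ≠ 0 := by positivity
      simp only [egfTerm, H.succ n, Nat.factorial_succ]
      push_cast
      field_simp
      ring
    have h1 := h n le_rfl
    have h2 := abs_egfTerm_egfShift_le (n := n) hr hK fun k hk => h k hk.le
    have h3 := abs_egfTerm_egfShift_le (n := n) hr (by positivity) fun k hk =>
      abs_egfTerm_egfShift_le hr (by positivity)
        fun j hj => H.abs_diag_le hr hq hK j fun i hi => h i (hi.trans (hj.trans hk).le)
    have h4 := abs_egfTerm_egfShift_le (n := n) hr (by positivity) fun k hk =>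
      abs_egfTerm_egfShift_le hr (by positivity)
        fun j hj => H.abs_offDiag_le hr hq hK j fun i hi => h i (hi.trans (hj.trans hk).le)
    have hn : (0 : ℝ) ≤ n + 1 := by positivity
    calc (n + 1) * |egfTerm r a (n + 1)| = |(n + 1) * egfTerm r a (n + 1)| := by
          rw [abs_mul, abs_of_nonneg hn]
      _ ≤ r * (|μ₂| * |egfTerm r a n| + |μ₄| * |egfTerm r (egfShift a) n| +
          μ₂ ^ 2 * (|egfTerm r (egfShift (egfShift γ)) n|
            + 2 * |egfTerm r (egfShift (egfShift β)) n|)) := by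
          rw [e, abs_mul, abs_of_nonneg hr]
          refine mul_le_mul_of_nonneg_left ((abs_add_le _ _).trans (add_le_add
            ((abs_add_le _ _).trans_eq (by simp only [abs_mul])) ?_)) hr
          rw [abs_mul, abs_of_nonneg (sq_nonneg μ₂)]
          refine mul_le_mul_of_nonneg_left ((abs_add_le _ _).trans_eq ?_) (sq_nonneg _)
          rw [abs_mul, abs_two]
      _ ≤ r * (|μ₂| * K + |μ₄| * (r * K) +
          μ₂ ^ 2 * (r * (r * (d * K)) + 2 * (r * (r * (c * K))))) := by gcongr
      _ = C * K := by rw [hC]; ring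
  obtain ⟨N, hN⟩ := exists_nat_ge C
  -- The sum dominates each of the first N+1 terms; the later ones satisfy n ≥ C.
  set K := ∑ k ∈ range (N + 1), |egfTerm r a k|
  have hK : 0 ≤ K := sum_nonneg fun _ _ => abs_nonneg _
  refine ⟨K, hK, fun n => ?_⟩
  induction n using Nat.strong_induction_on with
  | _ n ih =>
    by_cases hn : n ≤ N
    · exact single_le_sum (f := fun k => |egfTerm r a k|) (fun _ _ => abs_nonneg _)
        (mem_range.2 (Nat.lt_succ_of_le hn))
    · obtain ⟨m, rfl⟩ : ∃ m, n = m + 1 := ⟨n - 1, by omega⟩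
      have h1 := step K hK m fun k hk => ih k (Nat.lt_succ_of_le hk)
      have h2 : C ≤ (m : ℝ) + 1 := hN.trans (by exact_mod_cast (not_le.1 hn).le)
      have h3 : C * K ≤ ((m : ℝ) + 1) * K := mul_le_mul_of_nonneg_right h2 hK
      exact le_of_mul_le_mul_left (h1.trans h3) (by positivity)

theorem exists_radius {t : ℝ} (ht : |μ₂ * t| < 1) : ∃ r, |μ₂| * r < 1 ∧ |t| < r := by
  rw [abs_mul] at ht
  have h1 : ∀ᶠ r in nhdsWithin |t| (Set.Ioi |t|), |μ₂| * r < 1 :=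
    ((continuous_const.mul continuous_id).continuousAt.eventually_lt_const ht).filter_mono
      nhdsWithin_le_nhds
  obtain ⟨r, h⟩ := (h1.and self_mem_nhdsWithin).exists
  exact ⟨r, h⟩

theorem DetMomentRecursion.summable (H : DetMomentRecursion μ₂ μ₄ a β γ) {t : ℝ}
    (ht : |μ₂ * t| < 1) :
    Summable (egfTerm t a) ∧ Summable (egfTerm t β) ∧ Summable (egfTerm t γ) := by
  obtain ⟨r, hq, htr⟩ := exists_radius ht
  have hr : 0 ≤ r := (abs_nonneg t).trans htr.le
  obtain ⟨K, hK, hb⟩ := H.exists_bound hr hq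
  exact ⟨summable_egfTerm_of_bounded htr hb,
    summable_egfTerm_of_bounded htr fun n => H.abs_offDiag_le hr hq hK n fun k _ => hb k,
    summable_egfTerm_of_bounded htr fun n => H.abs_diag_le hr hq hK n fun k _ => hb k⟩

theorem one_sub_pos_of_abs_lt_one {x : ℝ} (h : |x| < 1) : 0 < 1 - x ∧ 0 < 1 - x ^ 2 := by
  refine ⟨by linarith [(abs_lt.1 h).2], ?_⟩
  have := (sq_lt_one_iff_abs_lt_one x).2 h
  linarith

/-- The generating functions of the cofactor moments in terms of that of the determinant. -/
theorem DetMomentRecursion.tsum_offDiag_diag (H : DetMomentRecursion μ₂ μ₄ a β γ) {t : ℝ}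
    (ht : |μ₂ * t| < 1) :
    ∑' n, egfTerm t β n = μ₂ / (1 - μ₂ * t) * ∑' n, egfTerm t a n ∧
    ∑' n, egfTerm t γ n = μ₂ ^ 2 * t / (1 - (μ₂ * t) ^ 2) * ∑' n, egfTerm t a n := by
  obtain ⟨h1, h2⟩ := one_sub_pos_of_abs_lt_one ht
  obtain ⟨sa, sβ, sγ⟩ := H.summable ht
  have hB := (sa.hasSum.add sβ.hasSum.egfShift).mul_left μ₂
  have hC := (sa.hasSum.egfShift.add sγ.hasSum.egfShift.egfShift).mul_left (μ₂ ^ 2)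
  have eB : ∑' n, egfTerm t β n = μ₂ * (∑' n, egfTerm t a n + t * ∑' n, egfTerm t β n) :=
    sβ.hasSum.unique (hB.congr_fun fun n => by simp only [egfTerm, H.offDiag n]; ring)
  have eC : ∑' n, egfTerm t γ n =
      μ₂ ^ 2 * (t * ∑' n, egfTerm t a n + t * (t * ∑' n, egfTerm t γ n)) :=
    sγ.hasSum.unique (hC.congr_fun fun n => by simp only [egfTerm, H.diag n]; ring)
  constructor
  · rw [div_mul_eq_mul_div, eq_div_iff h1.ne']
    linear_combination eB
  · rw [div_mul_eq_mul_div, eq_div_iff h2.ne']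
    linear_combination eC

theorem DetMomentRecursion.hasSum_succ (H : DetMomentRecursion μ₂ μ₄ a β γ) {t : ℝ}
    (ht : |μ₂ * t| < 1) : HasSum (egfTerm t fun n => a (n + 1))
      ((μ₂ + μ₄ * t + μ₂ ^ 2 * t ^ 2 * (μ₂ ^ 2 * t / (1 - (μ₂ * t) ^ 2)
        + 2 * (μ₂ / (1 - μ₂ * t)))) * ∑' n, egfTerm t a n) := by
  obtain ⟨sa, sβ, sγ⟩ := H.summable ht
  obtain ⟨eB, eC⟩ := H.tsum_offDiag_diag ht
  have h := ((sa.hasSum.mul_left μ₂).add (sa.hasSum.egfShift.mul_left μ₄)).add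
    ((sγ.hasSum.egfShift.egfShift.add (sβ.hasSum.egfShift.egfShift.mul_left 2)).mul_left (μ₂ ^ 2))
  rw [eB, eC] at h
  convert! h using 1
  · funext n
    simp only [egfTerm, H.succ n]
    ring
  · ring

theorem DetMomentRecursion.hasDerivAt (H : DetMomentRecursion μ₂ μ₄ a β γ) {t : ℝ}
    (ht : |μ₂ * t| < 1) : HasDerivAt (fun s => ∑' n, egfTerm s a n)
      ((μ₂ + μ₄ * t + μ₂ ^ 2 * t ^ 2 * (μ₂ ^ 2 * t / (1 - (μ₂ * t) ^ 2)
        + 2 * (μ₂ / (1 - μ₂ * t)))) * ∑' n, egfTerm t a n) t := by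
  obtain ⟨r, hr, htr⟩ := exists_radius ht
  have hq : |μ₂ * r| < 1 := by
    rwa [abs_mul, abs_of_nonneg ((abs_nonneg t).trans htr.le)]
  rw [← (H.hasSum_succ ht).tsum_eq]
  exact hasDerivAt_tsum_egfTerm htr (H.summable ht).1 (H.hasSum_succ hq).summable

theorem hasDerivAt_integratingFactor {t : ℝ} (ht : |μ₂ * t| < 1) :
    HasDerivAt (fun s => Real.exp (-((μ₄ - 3 * μ₂ ^ 2) * s ^ 2 / 2 - μ₂ * s))
        * ((1 - μ₂ * s) ^ 2 * √(1 - (μ₂ * s) ^ 2)))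
      (-(μ₂ + μ₄ * t + μ₂ ^ 2 * t ^ 2 * (μ₂ ^ 2 * t / (1 - (μ₂ * t) ^ 2)
        + 2 * (μ₂ / (1 - μ₂ * t)))) * (Real.exp (-((μ₄ - 3 * μ₂ ^ 2) * t ^ 2 / 2 - μ₂ * t))
        * ((1 - μ₂ * t) ^ 2 * √(1 - (μ₂ * t) ^ 2)))) t := by
  obtain ⟨h1, h2⟩ := one_sub_pos_of_abs_lt_one ht
  have hx : HasDerivAt (fun s : ℝ => μ₂ * s) μ₂ t := by simpa using (hasDerivAt_id t).const_mul μ₂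
  have hE : HasDerivAt (fun s : ℝ => Real.exp (-((μ₄ - 3 * μ₂ ^ 2) * s ^ 2 / 2 - μ₂ * s)))
      (Real.exp (-((μ₄ - 3 * μ₂ ^ 2) * t ^ 2 / 2 - μ₂ * t))
        * -((μ₄ - 3 * μ₂ ^ 2) * t - μ₂)) t := by
    refine (((((hasDerivAt_pow 2 t).const_mul (μ₄ - 3 * μ₂ ^ 2)).div_const 2).sub hx).neg.exp
      ).congr_deriv ?_
    norm_num
    ring
  have hs : √(1 - (μ₂ * t) ^ 2) ^ 2 = 1 - (μ₂ * t) ^ 2 := Real.sq_sqrt h2.le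
  have hs0 : √(1 - (μ₂ * t) ^ 2) ≠ 0 := (Real.sqrt_pos.2 h2).ne'
  have hS : HasDerivAt (fun s : ℝ => √(1 - (μ₂ * s) ^ 2))
      (-(μ₂ ^ 2 * t) / √(1 - (μ₂ * t) ^ 2)) t := by
    refine (((hx.fun_pow 2).const_sub 1).sqrt h2.ne').congr_deriv ?_
    norm_num
    field_simp
  have hW : HasDerivAt (fun s : ℝ => (1 - μ₂ * s) ^ 2) (-(2 * μ₂ * (1 - μ₂ * t))) t := by
    refine ((hx.const_sub 1).fun_pow 2).congr_deriv ?_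
    norm_num
    ring
  refine (hE.fun_mul (hW.fun_mul hS)).congr_deriv ?_
  set S := √(1 - (μ₂ * t) ^ 2)
  set E := Real.exp (-((μ₄ - 3 * μ₂ ^ 2) * t ^ 2 / 2 - μ₂ * t))
  clear_value S E
  -- Every 1 − (μ₂t)² becomes the square of the atom `S`, so that denominators clear; `hs` is used
  -- once more to close the polynomial identity.
  rw [← hs]
  have h1' := h1.ne'
  field_simp
  linear_combination E * μ₂ ^ 2 * t * (1 - μ₂ * t) * hs

/-- The series times the integrating factor has zero derivative on the convex set |μ₂x| < 1 and
equals 1 at the origin. -/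
theorem DetMomentRecursion.tsum_eq (H : DetMomentRecursion μ₂ μ₄ a β γ) {t : ℝ}
    (ht : |μ₂ * t| < 1) : ∑' n, egfTerm t a n =
      Real.exp ((μ₄ - 3 * μ₂ ^ 2) * t ^ 2 / 2 - μ₂ * t)
        / ((1 - μ₂ * t) ^ 2 * √(1 - (μ₂ * t) ^ 2)) := by
  set s : Set ℝ := {x | |μ₂ * x| < 1} with hs
  have ho : IsOpen s := isOpen_lt (by fun_prop) continuous_const
  have hc : IsPreconnected s := by
    have : s = (LinearMap.mulLeft ℝ μ₂) ⁻¹' Metric.ball 0 1 := by ext x; simp [hs]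
    rw [this]
    exact ((convex_ball (0 : ℝ) 1).linear_preimage _).isPreconnected
  have hd : ∀ x ∈ s, HasDerivAt (fun y => (∑' n, egfTerm y a n)
      * (Real.exp (-((μ₄ - 3 * μ₂ ^ 2) * y ^ 2 / 2 - μ₂ * y))
        * ((1 - μ₂ * y) ^ 2 * √(1 - (μ₂ * y) ^ 2)))) 0 x := fun x hx =>
    ((H.hasDerivAt hx).mul (hasDerivAt_integratingFactor hx)).congr_deriv (by ring)
  have h0 : ∑' n, egfTerm 0 a n = 1 := by
    rw [tsum_eq_single 0 fun n hn => by simp [egfTerm, hn]]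
    simp [egfTerm, H.zero]
  have := ho.is_const_of_deriv_eq_zero hc
    (fun x hx => (hd x hx).differentiableAt.differentiableWithinAt) (fun x hx => (hd x hx).deriv)
    (show t ∈ s from ht) (show (0 : ℝ) ∈ s by simp [hs])
  simp only [h0] at this
  obtain ⟨h1, h2⟩ := one_sub_pos_of_abs_lt_one ht
  have hs0 := (Real.sqrt_pos.2 h2).ne'
  rw [eq_div_iff (mul_ne_zero (pow_ne_zero 2 h1.ne') hs0)]
  have key : (∑' n, egfTerm t a n)
      * (Real.exp (-((μ₄ - 3 * μ₂ ^ 2) * t ^ 2 / 2 - μ₂ * t))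
        * ((1 - μ₂ * t) ^ 2 * √(1 - (μ₂ * t) ^ 2))) = 1 := by
    rw [this]; simp
  rw [Real.exp_neg] at key
  set E := Real.exp ((μ₄ - 3 * μ₂ ^ 2) * t ^ 2 / 2 - μ₂ * t) with hE
  have hE0 : E ≠ 0 := (Real.exp_pos _).ne'
  calc _ = E * ((∑' n, egfTerm t a n) * (E⁻¹ * ((1 - μ₂ * t) ^ 2 * √(1 - (μ₂ * t) ^ 2)))) := by
        field_simp
    _ = E := by rw [key, mul_one]

end Solution

/-! ### The second moment of the determinant -/

theorem IsCentred.detMomentRecursion {K : Type*} [Fintype K] {p z : K → ℝ} {μ₂ μ₃ μ₄ : ℝ}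
    (h : IsCentred p z μ₂ μ₃ μ₄) :
    DetMomentRecursion μ₂ μ₄ (detSqFin p z) (offDiagCofSq p z) (diagCofCof p z) where
  zero := h.detSq_zero
  succ := h.detSq_succ
  offDiag := h.offDiagCofSq_eq
  diag := h.diagCofCof_eq

theorem mainTheorem1 (ρ : Measure ℝ) [IsProbabilityMeasure ρ]
    (hρ : MemLp (id : ℝ → ℝ) 4 ρ)
    (m₁ μ₂ μ₃ μ₄ : ℝ)
    (hm₁ : m₁ = ∫ x, x ∂ρ)
    (hμ₂ : μ₂ = centralMoment id 2 ρ)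
    (hμ₃ : μ₃ = centralMoment id 3 ρ)
    (hμ₄ : μ₄ = centralMoment id 4 ρ)
    (Ω : ℕ → Type*) [∀ n, MeasurableSpace (Ω n)]
    (P : ∀ n, Measure (Ω n)) [∀ n, IsProbabilityMeasure (P n)]
    (X : ∀ n, Ω n → Matrix (Fin n) (Fin n) ℝ)
    (hX : ∀ n, IsIIDSymmetric ρ (P n) (X n)) :
    (∀ n, Integrable (fun ω => (X n ω).det ^ 2) (P n)) ∧
    ∀ t : ℝ, |μ₂ * t| < 1 →
      HasSum (fun n : ℕ => detMoment 2 (P n) (X n) * (t ^ n / (n.factorial : ℝ)))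
        ((1 + 2 * m₁ * μ₃ * t ^ 2
            + m₁ ^ 2 * (μ₃ ^ 2 * t ^ 4 + t / (1 - μ₂ ^ 2 * t ^ 2)
                + 2 * μ₂ * t ^ 2 / (1 - μ₂ * t)))
          * (Real.exp ((μ₄ - 3 * μ₂ ^ 2) * t ^ 2 / 2 - μ₂ * t)
              / ((1 - μ₂ * t) ^ 2 * Real.sqrt (1 - μ₂ ^ 2 * t ^ 2)))) := by
  refine ⟨fun n => (hX n).integrable_det_sq hρ, fun t ht => ?_⟩
  obtain ⟨p, z, hp⟩ := exists_quadrature hρ m₁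
  have h : IsCentred p z μ₂ μ₃ μ₄ := by
    subst hm₁ hμ₂ hμ₃ hμ₄
    exact isCentred_of_quadrature hp hρ
  have H := h.detMomentRecursion
  obtain ⟨sa, sβ, sγ⟩ := H.summable ht
  obtain ⟨eB, eC⟩ := H.tsum_offDiag_diag ht
  obtain ⟨h1, h2⟩ := one_sub_pos_of_abs_lt_one ht
  have hA := sa.hasSum
  have hB := sβ.hasSum
  have hC := sγ.hasSum
  rw [eB] at hB
  rw [eC] at hC
  have hsum := (hA.add (hA.egfShift.egfShift.mul_left (2 * m₁ * μ₃))).add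
    ((((hA.egfShift.add hC.egfShift.egfShift).add (hB.egfShift.egfShift.mul_left 2)).add
      (hA.egfShift.egfShift.egfShift.egfShift.mul_left (μ₃ ^ 2))).mul_left (m₁ ^ 2))
  have hx : μ₂ ^ 2 * t ^ 2 = (μ₂ * t) ^ 2 := by ring
  rw [hx, ← H.tsum_eq ht]
  convert! hsum using 1
  · funext n
    rw [(hX n).detMoment_two_eq_symE hρ hp, h.symE_det_add_const_sq]
    simp only [egfTerm]
    ring
  -- The identity needed is t + μ₂²t³/(1 − μ₂²t²) = t/(1 − μ₂²t²), which merges the diagonal squares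
  -- with the `γ` contribution.
  · have h3 := mul_inv_cancel₀ h2.ne'
    linear_combination (m₁ ^ 2 * t * ∑' n, egfTerm t (detSqFin p z) n) * h3
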